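/- All metric spaces below are finite unless stated otherwise. For a map $f:M\to X$ between metric spaces put $$\mathrm{dist}(f)=\sup_{x\neq y}\frac{d_X(f(x),f(y))}{d_M(x,y)}\cdot\sup_{x\neq y}\frac{d_M(x,y)}{d_X(f(x),f(y))},$$ and let the Euclidean distortion $c_2(M)$ be the infimum of $\mathrm{dist}(f)$ over all injective maps $f:M\to\ell_2$. Given a partition $\mathcal U$ of $M$ into nonempty pairwise disjoint subsets, put $d_M(U,V)=\min\{d_M(u,v):u\in U,\ v\in V\}$ for $U,V\in\mathcal U$. The $Q$ space of $M$ induced by $\mathcal U$ is the set $\mathcal U$ with the metric $$d_{\mathrm{geo}}(U,V)=\inf\Big\{\sum_{i=1}^{k} d_M(V_{i-1},V_i):\ k\ge 0,\ V_0,\dots,V_k\in\mathcal U,\ V_0=U,\ V_k=V\Big\}.$$ A $QS$ space of $M$ is a $Q$ space of a subset of $M$; an $SQ$ space of $M$ is a subset of a $Q$ space of $M$ with the induced metric. For $A\subseteq M$, $M/A$ denotes the $Q$ space induced by the partition consisting of $A$ and the singletons of the points of $M\setminus A$ (so $M/\emptyset=M$). The size of a space is its number of points, and $\log$ is the natural logarithm.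 **Theorem 1.7.** (1) There is a universal constant $C>0$ such that for every $0<\varepsilon<1$, every $n$ and every $n$-point metric space $M$ there is a set $A\subseteq M$ such that the $Q$ space $M/A$ has exactly $\lceil(1-\varepsilon)n\rceil$ points and $$c_2(M/A)\le C\log(2/\varepsilon).$$ (2) There is a universal constant $c>0$ such that for every $0<\varepsilon<1$ there are arbitrarily large $n$ and $n$-point metric spaces $Y$ such that every $QS$ space and every $SQ$ space $\mathcal U$ of $Y$ of size at least $(1-\varepsilon)n$ satisfies $$c_2(\mathcal U)\ge c\log(2/\varepsilon).$$ -/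

import Mathlib

open scoped ENNReal

universe u v

/-! ## Distortion of embeddings -/

/-- The distortion of a map between metric spaces: the product of the suprema, over pairs of
distinct points, of `d (f x) (f y) / d x y` and of `d x y / d (f x) (f y)`. -/
noncomputable def mapDistortion {M : Type u} {X : Type v} [MetricSpace M] [MetricSpace X]
    (f : M → X) : ℝ≥0∞ :=
  (⨆ (x : M) (y : M) (_ : x ≠ y), edist (f x) (f y) / edist x y) *
    (⨆ (x : M) (y : M) (_ : x ≠ y), edist x y / edist (f x) (f y))

/-- The least distortion (infimum over all injective maps) required to embed `M` in `X`. -/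
noncomputable def leastDistortion (M : Type u) (X : Type v) [MetricSpace M] [MetricSpace X] :
    ℝ≥0∞ :=
  ⨅ f : M ↪ X, mapDistortion (f : M → X)

/-- The Euclidean distortion of `M`: the least distortion required to embed `M` in the real
Hilbert space `ℓ₂`. -/
noncomputable def euclideanDistortion (M : Type u) [MetricSpace M] : ℝ≥0∞ :=
  leastDistortion M (lp (fun _ : ℕ => ℝ) 2)

/-! ## Quotients of finite metric spaces

A partition of `M` into nonempty pairwise disjoint subsets is given by the equivalence relation
whose classes are the parts; the parts are then the elements of `Quotient r`. -/

/-- The distance `inf {d(u, v) : u ∈ U, v ∈ V}` between two parts `U`, `V` of a partition. -/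
noncomputable def partDist {M : Type u} [MetricSpace M] (r : Setoid M) (U V : Quotient r) : ℝ :=
  sInf {t : ℝ | ∃ u v : M, Quotient.mk r u = U ∧ Quotient.mk r v = V ∧ t = dist u v}

/-- The geodesic distance between two parts: the infimum of `∑ d(V_{i}, V_{i+1})` over all
finite sequences of parts `V_0 = U, V_1, …, V_k = V`. -/
noncomputable def geoDist {M : Type u} [MetricSpace M] (r : Setoid M) (U V : Quotient r) : ℝ :=
  sInf {t : ℝ | ∃ (k : ℕ) (W : ℕ → Quotient r), W 0 = U ∧ W k = V ∧
    t = ∑ i ∈ Finset.range k, partDist r (W i) (W (i + 1))}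

/-- The set of parts of the partition with classes of `r`. It carries the geodesic metric
(see the instance below), and is then the `Q` space of `M` induced by the partition. -/
def QSpace {M : Type u} (r : Setoid M) : Type u := Quotient r

/-- The partition of `M` consisting of `A` and of the singletons of the points outside `A`
(of singletons only, if `A` is empty). -/
def collapseSetoid {M : Type u} (A : Set M) : Setoid M where
  r x y := x = y ∨ (x ∈ A ∧ y ∈ A)
  iseqv :=
    { refl := fun _ => Or.inl rfl
      symm := by
        rintro x y (h | ⟨h1, h2⟩)
        · exact Or.inl h.symm
        · exact Or.inr ⟨h2, h1⟩
      trans := by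
        rintro x y z (rfl | ⟨h1, h2⟩) (rfl | ⟨h3, h4⟩)
        · exact Or.inl rfl
        · exact Or.inr ⟨h3, h4⟩
        · exact Or.inr ⟨h1, h2⟩
        · exact Or.inr ⟨h1, h4⟩ }

/-- The `Q` space `M / A`, obtained by collapsing `A` to one point. -/
abbrev QuotientBySet {M : Type u} (A : Set M) : Type u := QSpace (collapseSetoid A)

section Metric

variable {M : Type u} [MetricSpace M] (r : Setoid M)

theorem partDist_nonneg (U V : Quotient r) : 0 ≤ partDist r U V := by
  apply Real.sInf_nonneg
  rintro t ⟨u, v, -, -, rfl⟩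
  exact dist_nonneg

theorem partDist_comm (U V : Quotient r) : partDist r U V = partDist r V U := by
  unfold partDist
  congr 1
  ext t
  constructor
  · rintro ⟨u, v, hu, hv, rfl⟩
    exact ⟨v, u, hv, hu, dist_comm u v⟩
  · rintro ⟨u, v, hu, hv, rfl⟩
    exact ⟨v, u, hv, hu, dist_comm u v⟩

theorem geoDist_bddBelow (U V : Quotient r) :
    BddBelow {t : ℝ | ∃ (k : ℕ) (W : ℕ → Quotient r), W 0 = U ∧ W k = V ∧
      t = ∑ i ∈ Finset.range k, partDist r (W i) (W (i + 1))} := by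
  refine ⟨0, ?_⟩
  rintro t ⟨k, W, -, -, rfl⟩
  exact Finset.sum_nonneg fun i _ => partDist_nonneg r _ _

theorem geoDist_nonempty (U V : Quotient r) :
    {t : ℝ | ∃ (k : ℕ) (W : ℕ → Quotient r), W 0 = U ∧ W k = V ∧
      t = ∑ i ∈ Finset.range k, partDist r (W i) (W (i + 1))}.Nonempty :=
  ⟨_, 1, fun i => if i = 0 then U else V, by simp, by simp, rfl⟩

theorem geoDist_nonneg (U V : Quotient r) : 0 ≤ geoDist r U V := by
  apply Real.sInf_nonneg
  rintro t ⟨k, W, -, -, rfl⟩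
  exact Finset.sum_nonneg fun i _ => partDist_nonneg r _ _

theorem geoDist_self (U : Quotient r) : geoDist r U U = 0 :=
  le_antisymm (csInf_le (geoDist_bddBelow r U U) ⟨0, fun _ => U, rfl, rfl, by simp⟩)
    (geoDist_nonneg r U U)

theorem geoDist_le_swap (U V : Quotient r) : geoDist r U V ≤ geoDist r V U := by
  refine le_csInf (geoDist_nonempty r V U) ?_
  rintro t ⟨k, W, h0, hk, rfl⟩
  refine csInf_le (geoDist_bddBelow r U V) ⟨k, fun i => W (k - i), by simpa, by simpa, ?_⟩
  rw [← Finset.sum_range_reflect]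
  refine Finset.sum_congr rfl fun i hi => ?_
  have hi' : i < k := Finset.mem_range.mp hi
  have e1 : k - 1 - i + 1 = k - i := by omega
  have e2 : k - 1 - i = k - (i + 1) := by omega
  rw [e1, e2, partDist_comm]

theorem geoDist_triangle (U V Z : Quotient r) :
    geoDist r U Z ≤ geoDist r U V + geoDist r V Z := by
  have key : ∀ a ∈ {t : ℝ | ∃ (k : ℕ) (W : ℕ → Quotient r), W 0 = U ∧ W k = V ∧
      t = ∑ i ∈ Finset.range k, partDist r (W i) (W (i + 1))},
      ∀ b ∈ {t : ℝ | ∃ (k : ℕ) (W : ℕ → Quotient r), W 0 = V ∧ W k = Z ∧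
      t = ∑ i ∈ Finset.range k, partDist r (W i) (W (i + 1))}, geoDist r U Z ≤ a + b := by
    rintro a ⟨k, W, h0, hk, rfl⟩ b ⟨l, W', h0', hl, rfl⟩
    refine csInf_le (geoDist_bddBelow r U Z)
      ⟨k + l, fun i => if i < k then W i else W' (i - k), ?_, ?_, ?_⟩
    · by_cases hk0 : 0 < k
      · simp [hk0, h0]
      · have : k = 0 := by omega
        subst this
        simp [h0', ← hk, h0]
    · simp [hl]
    · rw [Finset.sum_range_add]
      congr 1
      · refine Finset.sum_congr rfl fun i hi => ?_
        have hi' : i < k := Finset.mem_range.mp hi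
        by_cases h : i + 1 < k
        · simp [hi', h]
        · have e : k = i + 1 := by omega
          subst e
          simp [h0', hk]
      · refine Finset.sum_congr rfl fun i _ => ?_
        have e : k + i + 1 - k = i + 1 := by omega
        have e' : ¬ k + i + 1 < k := by omega
        simp [e, e']
  have h1 : ∀ b ∈ {t : ℝ | ∃ (k : ℕ) (W : ℕ → Quotient r), W 0 = V ∧ W k = Z ∧
      t = ∑ i ∈ Finset.range k, partDist r (W i) (W (i + 1))},
      geoDist r U Z - b ≤ geoDist r U V := fun b hb =>
    le_csInf (geoDist_nonempty r U V) fun a ha => by linarith [key a ha b hb]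
  have h2 : geoDist r U Z - geoDist r U V ≤ geoDist r V Z :=
    le_csInf (geoDist_nonempty r V Z) fun b hb => by linarith [h1 b hb]
  linarith

theorem exists_pos_le_partDist [Finite M] :
    ∃ δ : ℝ, 0 < δ ∧ ∀ U V : Quotient r, U ≠ V → δ ≤ partDist r U V := by
  obtain ⟨δ, hδ, h⟩ : ∃ δ : ℝ, 0 < δ ∧ ∀ x y : M, x ≠ y → δ ≤ dist x y := by
    have hfin : (Set.univ : Set M).Finite := Set.finite_univ
    rcases isEmpty_or_nonempty {p : M × M // p.1 ≠ p.2} with he | hne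
    · exact ⟨1, one_pos, fun x y hxy => (he.false ⟨(x, y), hxy⟩).elim⟩
    · obtain ⟨p, hp⟩ := Finite.exists_min
        (fun p : {p : M × M // p.1 ≠ p.2} => dist p.1.1 p.1.2)
      exact ⟨dist p.1.1 p.1.2, dist_pos.mpr p.2, fun x y hxy => hp ⟨(x, y), hxy⟩⟩
  refine ⟨δ, hδ, fun U V hUV => le_csInf ?_ ?_⟩
  · obtain ⟨u, hu⟩ := Quotient.exists_rep U
    obtain ⟨v, hv⟩ := Quotient.exists_rep V
    exact ⟨_, u, v, hu, hv, rfl⟩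
  · rintro t ⟨u, v, rfl, rfl, rfl⟩
    exact h u v fun huv => hUV (by rw [huv])

theorem eq_of_geoDist_eq_zero [Finite M] {U V : Quotient r} (h : geoDist r U V = 0) :
    U = V := by
  by_contra hUV
  obtain ⟨δ, hδ, hd⟩ := exists_pos_le_partDist r
  have : δ ≤ geoDist r U V := by
    refine le_csInf (geoDist_nonempty r U V) ?_
    rintro t ⟨k, W, h0, hk, rfl⟩
    have hex : ∃ i, i < k ∧ W i ≠ W (i + 1) := by
      by_contra hcon
      push Not at hcon
      have hall : ∀ i, i ≤ k → W i = U := by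
        intro i
        induction i with
        | zero => intro _; exact h0
        | succ j ih => intro hj; rw [← hcon j (by omega)]; exact ih (by omega)
      exact hUV ((hall k le_rfl).symm.trans hk)
    obtain ⟨i, hi, hne⟩ := hex
    exact (hd _ _ hne).trans (Finset.single_le_sum
      (f := fun i => partDist r (W i) (W (i + 1)))
      (fun j _ => partDist_nonneg r _ _) (Finset.mem_range.mpr hi))
  linarith

end Metric

/-- The geodesic metric on the set of parts. -/
noncomputable instance instMetricSpaceQSpace {M : Type u} [MetricSpace M] [Finite M]
    (r : Setoid M) : MetricSpace (QSpace r) where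
  dist U V := geoDist r U V
  dist_self U := geoDist_self r U
  dist_comm U V := le_antisymm (geoDist_le_swap r U V) (geoDist_le_swap r V U)
  dist_triangle U V Z := geoDist_triangle r U V Z
  eq_of_dist_eq_zero h := eq_of_geoDist_eq_zero r h

/-!
Upper bound. Fix `L` with `2 ^ L` about `1 / ε`. Choosing disjoint balls with `2 ^ L` points greedily,
in order of increasing radius, gives a set `A` of at most `ε n` centres such that about every point
`x` the ball of radius half the distance to `A` has fewer than `2 ^ L` points (`exists_net`). This
property survives enlarging `A`, so `A` can be given the size that `M / A` requires. In `M / A` two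
points are either separated by the function `d(·, A)`, or are both far from `A` compared with their
distance in `M / A`; in the latter case Bourgain's random sets separate them, and only the `L` densities
`1 / 2, …, 1 / 2 ^ L` are needed because the relevant balls have fewer than `2 ^ L` points
(`sum_scales_ge`). Taking distances to the union of `A` and the random set makes the coordinates
well defined and `1`-Lipschitz on `M / A`. The distortion is `O(L)`, that is, `O(log (2 / ε))`
(`euclideanDistortion_quotientBySet_le`).

Lower bound. Let `G` have fewer than `1 / (2 ε)` points and let `Y` consist of many copies of `G`
whose mutual distance is at least the diameter of `G`. A `QS` or `SQ` space of `Y` that loses at most an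
`ε`-fraction of the points leaves one copy intact by the pigeonhole principle (`exists_intact_fiber`),
and a path that leaves this copy is too long to be a shortcut, so the copy sits isometrically in the
space (`isometry_mk_of_far`). It remains to find `G` with `1024 ^ l` points and Euclidean distortion at
least a multiple of `l`: a Cayley graph of `𝔽₂ᵐ`, `m = 10 l`, with `8 m` generators on which every
nontrivial character is `-1` at least `m` times. Random generators have this property
(`exists_expanding_generators`), Fourier analysis turns it into a Poincaré inequality
(`poincare_bits`), and most pairs of points are at word distance greater than `l` because few vectors
are sums of `l` generators (`card_wordNorm_le`).
-/

/-! ### Distortion and geodesic distances -/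

theorem mapDistortion_le {M : Type u} {X : Type v} [MetricSpace M] [MetricSpace X] (f : M → X)
    {L K : ℝ} (hL : 0 ≤ L) (hK : 0 ≤ K) (h1 : ∀ x y, dist (f x) (f y) ≤ L * dist x y)
    (h2 : ∀ x y, dist x y ≤ K * dist (f x) (f y)) :
    mapDistortion f ≤ ENNReal.ofReal (L * K) := by
  rw [ENNReal.ofReal_mul hL]
  refine mul_le_mul' (iSup_le fun x => iSup_le fun y => iSup_le fun _ => ?_)
    (iSup_le fun x => iSup_le fun y => iSup_le fun _ => ?_)
  · refine ENNReal.div_le_of_le_mul ?_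
    rw [edist_dist, edist_dist, ← ENNReal.ofReal_mul hL]
    exact ENNReal.ofReal_le_ofReal (h1 x y)
  · refine ENNReal.div_le_of_le_mul ?_
    rw [edist_dist, edist_dist, ← ENNReal.ofReal_mul hK]
    exact ENNReal.ofReal_le_ofReal (h2 x y)

/-- To bound the distortion below it suffices to treat finite Lipschitz constants: both suprema are
nonzero, so the product is infinite as soon as one of them is. -/
theorem le_mapDistortion {M : Type u} {X : Type v} [MetricSpace M] [MetricSpace X] [Nontrivial M]
    (f : M ↪ X) {c : ℝ}
    (h : ∀ L K : ℝ, 0 ≤ L → 0 ≤ K → (∀ x y, dist (f x) (f y) ≤ L * dist x y) →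
      (∀ x y, dist x y ≤ K * dist (f x) (f y)) → c ≤ L * K) :
    ENNReal.ofReal c ≤ mapDistortion f := by
  unfold mapDistortion
  set a : ℝ≥0∞ := ⨆ (x : M) (y : M) (_ : x ≠ y), edist (f x) (f y) / edist x y with ha
  set b : ℝ≥0∞ := ⨆ (x : M) (y : M) (_ : x ≠ y), edist x y / edist (f x) (f y) with hb
  have hale : ∀ x y, x ≠ y → edist (f x) (f y) / edist x y ≤ a := fun x y hxy =>
    le_iSup_of_le x (le_iSup_of_le y (le_iSup_of_le hxy le_rfl))
  have hble : ∀ x y, x ≠ y → edist x y / edist (f x) (f y) ≤ b := fun x y hxy =>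
    le_iSup_of_le x (le_iSup_of_le y (le_iSup_of_le hxy le_rfl))
  obtain ⟨x₀, y₀, hxy⟩ := exists_pair_ne M
  have ha0 : a ≠ 0 := by
    intro h0
    have := hale x₀ y₀ hxy
    rw [h0, nonpos_iff_eq_zero, ENNReal.div_eq_zero_iff] at this
    rcases this with h | h
    · exact hxy (f.injective (edist_eq_zero.mp h))
    · exact edist_ne_top _ _ h
  have hb0 : b ≠ 0 := by
    intro h0
    have := hble x₀ y₀ hxy
    rw [h0, nonpos_iff_eq_zero, ENNReal.div_eq_zero_iff] at this
    rcases this with h | h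
    · exact hxy (edist_eq_zero.mp h)
    · exact edist_ne_top _ _ h
  by_cases hat : a = ⊤
  · rw [hat, ENNReal.top_mul hb0]; exact le_top
  by_cases hbt : b = ⊤
  · rw [hbt, ENNReal.mul_top ha0]; exact le_top
  rw [← ENNReal.ofReal_toReal hat, ← ENNReal.ofReal_toReal hbt,
    ← ENNReal.ofReal_mul ENNReal.toReal_nonneg]
  refine ENNReal.ofReal_le_ofReal (h _ _ ENNReal.toReal_nonneg ENNReal.toReal_nonneg ?_ ?_)
  · intro x y
    rcases eq_or_ne x y with rfl | hne
    · simp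
    have := ENNReal.toReal_mono hat (hale x y hne)
    rw [ENNReal.toReal_div, edist_dist, edist_dist, ENNReal.toReal_ofReal dist_nonneg,
      ENNReal.toReal_ofReal dist_nonneg, div_le_iff₀ (dist_pos.mpr hne)] at this
    exact this
  · intro x y
    rcases eq_or_ne x y with rfl | hne
    · simp
    have := ENNReal.toReal_mono hbt (hble x y hne)
    rw [ENNReal.toReal_div, edist_dist, edist_dist, ENNReal.toReal_ofReal dist_nonneg,
      ENNReal.toReal_ofReal dist_nonneg,
      div_le_iff₀ (dist_pos.mpr (f.injective.ne hne))] at this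
    exact this

theorem one_le_euclideanDistortion (M : Type u) [MetricSpace M] [Nontrivial M] :
    1 ≤ euclideanDistortion M := by
  refine le_iInf fun f => ?_
  rw [← ENNReal.ofReal_one]
  refine le_mapDistortion f fun L K hL _ h1 h2 => ?_
  obtain ⟨x, y, hxy⟩ := exists_pair_ne M
  have h3 : dist x y ≤ L * K * dist x y := by
    nlinarith [h1 x y, h2 x y, mul_le_mul_of_nonneg_left (h2 x y) hL, dist_nonneg (x := x) (y := y)]
  exact le_of_mul_le_mul_right (by linarith) (dist_pos.mpr hxy)

theorem euclideanDistortion_le_of_isometry {M : Type u} {X : Type v} [MetricSpace M]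
    [MetricSpace X] {φ : M → X} (hφ : Isometry φ) :
    euclideanDistortion M ≤ euclideanDistortion X := by
  refine le_iInf fun f => iInf_le_of_le (⟨f ∘ φ, f.injective.comp hφ.injective⟩ : M ↪ _) ?_
  refine mul_le_mul' (iSup_le fun x => iSup_le fun y => iSup_le fun hxy => ?_)
    (iSup_le fun x => iSup_le fun y => iSup_le fun hxy => ?_)
  · refine le_iSup_of_le (φ x) (le_iSup_of_le (φ y) (le_iSup_of_le (hφ.injective.ne hxy) ?_))
    simp [hφ.edist_eq]
  · refine le_iSup_of_le (φ x) (le_iSup_of_le (φ y) (le_iSup_of_le (hφ.injective.ne hxy) ?_))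
    simp [hφ.edist_eq]

theorem exists_map_lp_dist_sq (ι : Type v) [Fintype ι] :
    ∃ T : (ι → ℝ) → lp (fun _ : ℕ => ℝ) 2,
      ∀ u v, dist (T u) (T v) ^ 2 = ∑ i, (u i - v i) ^ 2 := by
  classical
  set e : ι ↪ ℕ := (Fintype.equivFin ι).toEmbedding.trans Fin.valEmbedding
  refine ⟨fun u => ∑ i, lp.single 2 (e i) (u i), fun u v => ?_⟩
  have h1 : (∑ i, lp.single 2 (e i) (u i) - ∑ i, lp.single 2 (e i) (v i) :
      lp (fun _ : ℕ => ℝ) 2) =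
      ∑ k ∈ Finset.univ.map e, lp.single 2 k (Function.extend e (fun i => u i - v i) 0 k) := by
    rw [Finset.sum_map, ← Finset.sum_sub_distrib]
    refine Finset.sum_congr rfl fun i _ => ?_
    rw [e.injective.extend_apply]
    exact (lp.single_sub (E := fun _ : ℕ => ℝ) 2 (e i) (u i) (v i)).symm
  have h2 := lp.norm_sum_single (E := fun _ : ℕ => ℝ) (p := 2) (by norm_num)
    (Function.extend e (fun i => u i - v i) 0) (Finset.univ.map e)
  rw [dist_eq_norm, h1]
  rw [Finset.sum_map] at h2 ⊢
  norm_num at h2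
  rw [h2]
  exact Finset.sum_congr rfl fun i _ => by rw [e.injective.extend_apply]

/-- A finite family of functions on `X`, `1`-Lipschitz and with weighted `ℓ₁` lower bound `c`,
gives a Euclidean embedding of distortion `W / c`, where `W` is the total weight: by the
Cauchy-Schwarz inequality the `ℓ₁` lower bound passes to `ℓ₂`. -/
theorem euclideanDistortion_le_of_weighted {X : Type u} [MetricSpace X] {ι : Type v} [Fintype ι]
    (w : ι → ℝ) (hw : ∀ i, 0 ≤ w i) (F : ι → X → ℝ) {c : ℝ} (hc : 0 < c)
    (hF : ∀ i x y, |F i x - F i y| ≤ dist x y)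
    (hlow : ∀ x y, c * dist x y ≤ ∑ i, w i * |F i x - F i y|) :
    euclideanDistortion X ≤ ENNReal.ofReal ((∑ i, w i) / c) := by
  obtain ⟨T, hT⟩ := exists_map_lp_dist_sq ι
  set W := ∑ i, w i with hW
  have hW0 : 0 ≤ W := Finset.sum_nonneg fun i _ => hw i
  set f : X → lp (fun _ : ℕ => ℝ) 2 := fun x => T fun i => √(w i) * F i x with hf
  have hdist : ∀ x y, dist (f x) (f y) ^ 2 = ∑ i, w i * |F i x - F i y| ^ 2 := by
    intro x y
    rw [hf, hT]
    refine Finset.sum_congr rfl fun i _ => ?_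
    rw [← mul_sub, mul_pow, Real.sq_sqrt (hw i), sq_abs]
  have hup : ∀ x y, dist (f x) (f y) ≤ √W * dist x y := by
    intro x y
    refine le_of_sq_le_sq ?_ (by positivity)
    rw [hdist, mul_pow, Real.sq_sqrt hW0, hW, Finset.sum_mul]
    exact Finset.sum_le_sum fun i _ =>
      mul_le_mul_of_nonneg_left (pow_le_pow_left₀ (abs_nonneg _) (hF i x y) 2) (hw i)
  have hdown : ∀ x y, dist x y ≤ √W / c * dist (f x) (f y) := by
    intro x y
    rw [div_mul_eq_mul_div, le_div_iff₀ hc, mul_comm]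
    refine (hlow x y).trans (le_of_sq_le_sq ?_ (by positivity))
    rw [mul_pow, Real.sq_sqrt hW0, hdist]
    have := Finset.sum_mul_sq_le_sq_mul_sq Finset.univ (fun i => √(w i))
      (fun i => √(w i) * |F i x - F i y|)
    simp only [← mul_assoc, mul_pow, Real.sq_sqrt (hw _), Real.mul_self_sqrt (hw _)] at this
    exact this
  have hinj : Function.Injective f := by
    intro x y hxy
    have := hdown x y
    rw [hxy, dist_self, mul_zero] at this
    exact dist_le_zero.mp this
  refine (iInf_le _ (⟨f, hinj⟩ : X ↪ _)).trans ?_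
  refine (mapDistortion_le f (Real.sqrt_nonneg W) (by positivity) hup hdown).trans_eq ?_
  rw [mul_div_assoc', Real.mul_self_sqrt hW0]

/-- A `1`-Lipschitz function that is constant on the parts is `1`-Lipschitz for the geodesic
distance. -/
theorem abs_sub_le_geoDist {M : Type u} [MetricSpace M] (r : Setoid M) (F : M → ℝ)
    (hF : ∀ x y, |F x - F y| ≤ dist x y) (hr : ∀ x y, r x y → F x = F y) (x y : M) :
    |F x - F y| ≤ geoDist r (Quotient.mk r x) (Quotient.mk r y) := by
  set G : Quotient r → ℝ := Quotient.lift F hr with hG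
  have hpart : ∀ U V : Quotient r, |G U - G V| ≤ partDist r U V := by
    intro U V
    refine le_csInf ?_ ?_
    · obtain ⟨u, hu⟩ := Quotient.exists_rep U
      obtain ⟨v, hv⟩ := Quotient.exists_rep V
      exact ⟨_, u, v, hu, hv, rfl⟩
    · rintro t ⟨u, v, rfl, rfl, rfl⟩
      exact hF u v
  refine le_csInf (geoDist_nonempty r _ _) ?_
  rintro t ⟨k, W, h0, hk, rfl⟩
  have key : ∀ j : ℕ, |G (W 0) - G (W j)| ≤ ∑ i ∈ Finset.range j, partDist r (W i) (W (i + 1)) := by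
    intro j
    induction j with
    | zero => simp
    | succ j ih =>
      rw [Finset.sum_range_succ]
      exact (abs_sub_le _ (G (W j)) _).trans (add_le_add ih (hpart _ _))
  have := key k
  rwa [h0, hk] at this

theorem geoDist_mk_le_dist {M : Type u} [MetricSpace M] (r : Setoid M) (x y : M) :
    geoDist r (Quotient.mk r x) (Quotient.mk r y) ≤ dist x y := by
  refine (csInf_le (geoDist_bddBelow r _ _) ⟨1, fun i => if i = 0 then Quotient.mk r x else
    Quotient.mk r y, by simp, by simp, rfl⟩).trans ?_
  simp only [Finset.sum_range_one]
  refine csInf_le ⟨0, ?_⟩ ⟨x, y, by simp, by simp, rfl⟩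
  rintro t ⟨u, v, -, -, rfl⟩
  exact dist_nonneg

/-! ### Nets adapted to the counting measure -/

/-- The greedy construction of `exists_net` on the points `S` that are still available: only balls
inside `S` count, and a ball that is lost in passing from `S` to `S \ B` meets the chosen ball `B`,
whose radius is not larger. Radii are distances between points. -/
theorem exists_net_of_subset {M : Type u} [MetricSpace M] [Fintype M] [DecidableEq M] {m : ℕ}
    (S : Finset M) : ∃ A : Finset M, A.card * m ≤ S.card ∧
      ∀ x y : M, m ≤ (Finset.univ.filter fun z => dist x z ≤ dist x y).card →
        (Finset.univ.filter fun z => dist x z ≤ dist x y) ⊆ S →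
        ∃ a ∈ A, dist x a ≤ 2 * dist x y := by
  induction S using Finset.strongInduction with
  | H S ih =>
    set B : M × M → Finset M := fun p => Finset.univ.filter fun z => dist p.1 z ≤ dist p.1 p.2
      with hB
    set P : Finset (M × M) := Finset.univ.filter fun p => m ≤ (B p).card ∧ B p ⊆ S with hP
    rcases P.eq_empty_or_nonempty with hemp | hne
    · refine ⟨∅, by simp, fun x y h1 h2 => ?_⟩
      have : (x, y) ∈ P := by simp only [hP, Finset.mem_filter]; exact ⟨Finset.mem_univ _, h1, h2⟩
      rw [hemp] at this
      exact absurd this (Finset.notMem_empty _)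
    · obtain ⟨p, hp, hmin⟩ := P.exists_min_image (fun p => dist p.1 p.2) hne
      have hp' := (Finset.mem_filter.mp hp).2
      have hpB : p.1 ∈ B p := by simp [hB]
      obtain ⟨A, hA1, hA2⟩ := ih (S \ B p) (Finset.sdiff_ssubset hp'.2 ⟨_, hpB⟩)
      refine ⟨insert p.1 A, ?_, fun x y h1 h2 => ?_⟩
      · rw [Finset.card_sdiff_of_subset hp'.2] at hA1
        have h3 := Finset.card_le_card hp'.2
        have h4 := Finset.card_insert_le p.1 A
        calc (insert p.1 A).card * m ≤ (A.card + 1) * m := Nat.mul_le_mul_right _ h4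
          _ = A.card * m + m := by ring
          _ ≤ S.card := by omega
      · by_cases hd : Disjoint (B (x, y)) (B p)
        · obtain ⟨a, ha, hxa⟩ := hA2 x y h1 (Finset.subset_sdiff.mpr ⟨h2, hd⟩)
          exact ⟨a, Finset.mem_insert_of_mem ha, hxa⟩
        · rw [Finset.not_disjoint_iff] at hd
          obtain ⟨z, hz1, hz2⟩ := hd
          have hxy : (x, y) ∈ P := Finset.mem_filter.mpr ⟨Finset.mem_univ _, h1, h2⟩
          have h3 := hmin _ hxy
          simp only [hB, Finset.mem_filter, Finset.mem_univ, true_and] at hz1 hz2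
          refine ⟨p.1, Finset.mem_insert_self _ _, ?_⟩
          have := dist_triangle_right x p.1 z
          simp only at h3
          linarith

/-- A set of at most `|M| / m` points which, at every point `x`, cuts off the large balls: the open
ball at `x` whose radius is half the distance to the set has fewer than `m` points. The set consists
of the centres of disjoint balls with at least `m` points, chosen in order of increasing radius. -/
theorem exists_net {M : Type u} [MetricSpace M] [Fintype M] {m : ℕ} (hm : 0 < m) :
    ∃ A : Finset M, A.card * m ≤ Fintype.card M ∧ ∀ B : Set M, (A : Set M) ⊆ B → ∀ x : M,
      (Finset.univ.filter fun z => 2 * dist x z < Metric.infDist x B).card < m := by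
  classical
  obtain ⟨A, hA1, hA2⟩ := exists_net_of_subset (m := m) (Finset.univ : Finset M)
  refine ⟨A, by simpa using hA1, fun B hAB x => ?_⟩
  by_contra! hcon
  set U : Finset M := Finset.univ.filter fun z => 2 * dist x z < Metric.infDist x B with hU
  have hne : U.Nonempty := Finset.card_pos.mp (hm.trans_le hcon)
  obtain ⟨y, hy, hmax⟩ := U.exists_max_image (dist x) hne
  obtain ⟨a, ha, hxa⟩ := hA2 x y (hcon.trans (Finset.card_le_card fun z hz => by
    simpa using hmax z hz)) (Finset.subset_univ _)
  have h1 : 2 * dist x y < Metric.infDist x B := by simpa [hU] using hy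
  have h2 := Metric.infDist_le_dist_of_mem (x := x) (hAB ha)
  linarith

/-! ### Random sets -/

theorem card_filter_forall_ne {M : Type u} [Fintype M] [DecidableEq M] {q : ℕ} [NeZero q] (U : Finset M) :
    ((Finset.univ.filter fun g : M → Fin q => ∀ z ∈ U, g z ≠ 0).card : ℝ) =
      (1 - 1 / (q : ℝ)) ^ U.card * (q : ℝ) ^ Fintype.card M := by
  have h1 : (Finset.univ.filter fun g : M → Fin q => ∀ z ∈ U, g z ≠ 0) =
      Fintype.piFinset fun z => if z ∈ U then Finset.univ.erase (0 : Fin q) else Finset.univ := by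
    ext g
    simp only [Finset.mem_filter, Finset.mem_univ, true_and, Fintype.mem_piFinset]
    refine forall_congr' fun z => ?_
    by_cases h : z ∈ U <;> simp [h]
  have hq : (q : ℝ) ≠ 0 := Nat.cast_ne_zero.mpr (NeZero.ne q)
  have hq1 : 1 ≤ q := NeZero.one_le
  rw [h1, Fintype.card_piFinset]
  push_cast
  have h2 : ∀ z : M, (((if z ∈ U then Finset.univ.erase (0 : Fin q) else Finset.univ).card : ℕ) : ℝ)
      = (if z ∈ U then (1 - 1 / (q : ℝ)) else 1) * q := by
    intro z
    by_cases h : z ∈ U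
    · simp only [h, if_true, Finset.card_erase_of_mem (Finset.mem_univ _), Finset.card_univ,
        Fintype.card_fin]
      rw [Nat.cast_sub hq1]
      field_simp
      simp
    · simp [h]
  simp_rw [h2]
  rw [Finset.prod_mul_distrib, Finset.prod_const, Finset.prod_ite_mem, Finset.univ_inter,
    Finset.prod_const, Finset.card_univ]

/-- A random set of density `1 / (2 k)` misses a set of at most `2 k` points and hits a disjoint set
of at least `k` points with probability at least `1 / 12`. The random set is the zero set of a
uniformly distributed `g : M → Fin (2 k)`. -/
theorem card_miss_and_hit {M : Type u} [Fintype M] [DecidableEq M] {k q : ℕ} [NeZero q] (hk : 0 < k)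
    (hq : q = 2 * k) (U V : Finset M) (hU : U.card ≤ 2 * k) (hV : k ≤ V.card) (hUV : Disjoint U V) :
    (q : ℝ) ^ Fintype.card M / 12 ≤
      ((Finset.univ.filter fun g : M → Fin q => (∀ z ∈ U, g z ≠ 0) ∧ ∃ z ∈ V, g z = 0).card : ℝ) := by
  have h1 := card_filter_forall_ne (q := q) U
  have h2 := card_filter_forall_ne (q := q) (U ∪ V)
  rw [Finset.card_union_of_disjoint hUV, pow_add] at h2
  have h3 : (Finset.univ.filter fun g : M → Fin q => ∀ z ∈ U, g z ≠ 0).card =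
      (Finset.univ.filter fun g : M → Fin q => (∀ z ∈ U, g z ≠ 0) ∧ ∃ z ∈ V, g z = 0).card +
      (Finset.univ.filter fun g : M → Fin q => ∀ z ∈ U ∪ V, g z ≠ 0).card := by
    rw [← Finset.card_filter_add_card_filter_not (s := Finset.univ.filter fun g : M → Fin q =>
      ∀ z ∈ U, g z ≠ 0) (fun g => ∃ z ∈ V, g z = 0), Finset.filter_filter, Finset.filter_filter]
    congr 2
    ext g
    simp only [Finset.mem_filter, Finset.mem_univ, true_and, Finset.mem_union, not_exists, not_and]
    constructor
    · rintro ⟨h, h'⟩ z (hz | hz)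
      exacts [h z hz, h' z hz]
    · exact fun h => ⟨fun z hz => h z (Or.inl hz), fun z hz => h z (Or.inr hz)⟩
  have hk1 : (1 : ℝ) ≤ k := by exact_mod_cast hk
  have hqR : (q : ℝ) = 2 * k := by rw [hq]; push_cast; ring
  set p : ℝ := 1 - 1 / (q : ℝ) with hp
  have hp0 : 0 ≤ p := by
    rw [hp, sub_nonneg, div_le_one (by rw [hqR]; linarith)]; rw [hqR]; linarith
  have hp1 : p ≤ 1 := by rw [hp]; have : 0 ≤ 1 / (q : ℝ) := by positivity
                         linarith
  have hpk : (1 : ℝ) / 2 ≤ p ^ k := by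
    have := one_add_mul_le_pow (a := -(1 / (q : ℝ))) (by
      have : 1 / (q : ℝ) ≤ 1 := by linarith
      linarith) k
    rw [← sub_eq_add_neg] at this
    refine le_trans (le_of_eq ?_) this
    rw [hqR]; field_simp; norm_num
  have hpk2 : p ^ k ≤ 2 / 3 := by
    -- Bernoulli's inequality for the inverse `1 + 1 / (2 k - 1)` of `p`
    have h4 := one_add_mul_le_pow (a := 1 / (2 * (k : ℝ) - 1)) (by
      have : 0 ≤ 1 / (2 * (k : ℝ) - 1) := by apply div_nonneg <;> linarith
      linarith) k
    have h5 : p * (1 + 1 / (2 * (k : ℝ) - 1)) = 1 := by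
      rw [hp, hqR]
      have : 2 * (k : ℝ) - 1 ≠ 0 := by linarith
      field_simp
      ring
    have h6 : p ^ k * (1 + 1 / (2 * (k : ℝ) - 1)) ^ k = 1 := by rw [← mul_pow, h5, one_pow]
    have h7 : (3 : ℝ) / 2 ≤ 1 + k * (1 / (2 * (k : ℝ) - 1)) := by
      have : (1 : ℝ) / 2 ≤ k * (1 / (2 * (k : ℝ) - 1)) := by
        rw [mul_one_div, div_le_div_iff₀ (by norm_num) (by linarith)]; linarith
      linarith
    nlinarith [h7.trans h4]
  have hpU : (1 : ℝ) / 4 ≤ p ^ U.card := by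
    calc (1 : ℝ) / 4 ≤ (p ^ k) ^ 2 := by nlinarith
      _ = p ^ (2 * k) := by rw [← pow_mul, mul_comm]
      _ ≤ p ^ U.card := pow_le_pow_of_le_one hp0 hp1 hU
  have hpV : p ^ V.card ≤ 2 / 3 := (pow_le_pow_of_le_one hp0 hp1 hV).trans hpk2
  have h3' : ((Finset.univ.filter fun g : M → Fin q => ∀ z ∈ U, g z ≠ 0).card : ℝ) =
      (Finset.univ.filter fun g : M → Fin q => (∀ z ∈ U, g z ≠ 0) ∧ ∃ z ∈ V, g z = 0).card +
      (Finset.univ.filter fun g : M → Fin q => ∀ z ∈ U ∪ V, g z ≠ 0).card := by exact_mod_cast h3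
  rw [h1, h2] at h3'
  have hQ : 0 ≤ (q : ℝ) ^ Fintype.card M := by positivity
  have h8 : (1 : ℝ) / 12 ≤ p ^ U.card * (1 - p ^ V.card) := by
    calc (1 : ℝ) / 12 = 1 / 4 * (1 / 3) := by norm_num
      _ ≤ _ := mul_le_mul hpU (by linarith) (by norm_num) (by linarith)
  nlinarith [mul_le_mul_of_nonneg_right h8 hQ]

/-! ### Bourgain's embedding relative to a set -/

/-- The radius at which the ball about `x` reaches `k` points, cut off at `T`. -/
theorem exists_radius_one {M : Type u} [MetricSpace M] [Fintype M] {k : ℕ} (hk : 0 < k) {T : ℝ} (hT : 0 ≤ T)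
    (x : M) : ∃ r, 0 ≤ r ∧ r ≤ T ∧
      (r < T → k ≤ (Finset.univ.filter fun z => dist x z ≤ r).card) ∧
      (r = 0 ∨ (Finset.univ.filter fun z => dist x z < r).card < k) := by
  by_cases h : (Finset.univ.filter fun z => dist x z < T).card < k
  · exact ⟨T, hT, le_rfl, fun h' => absurd h' (lt_irrefl _), Or.inr h⟩
  push Not at h
  have far : ∀ r : ℝ, k ≤ (Finset.univ.filter fun z => dist x z < r).card →
      ∃ y, dist x y < r ∧ k ≤ (Finset.univ.filter fun z => dist x z ≤ dist x y).card := by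
    intro r hr
    obtain ⟨y, hy, hmax⟩ := (Finset.univ.filter fun z => dist x z < r).exists_max_image (dist x)
      (Finset.card_pos.mp (hk.trans_le hr))
    exact ⟨y, by simpa using hy, hr.trans (Finset.card_le_card fun z hz => by
      simpa using hmax z hz)⟩
  obtain ⟨y₀, hy₀, hk₀⟩ := far T h
  obtain ⟨y, hy, hmin⟩ := (Finset.univ.filter fun y => k ≤
    (Finset.univ.filter fun z => dist x z ≤ dist x y).card).exists_min_image (dist x)
    ⟨y₀, by simpa using hk₀⟩
  refine ⟨dist x y, dist_nonneg, ((hmin y₀ (by simpa using hk₀)).trans_lt hy₀).le,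
    fun _ => by simpa using hy, Or.inr ?_⟩
  by_contra! hcon
  obtain ⟨y', h1, h2⟩ := far _ hcon
  exact absurd (hmin y' (by simpa using h2)) (not_le.mpr h1)

/-- The radius at which the balls about `x` and about `y` both reach `k` points, cut off at `T`. -/
theorem exists_radius {M : Type u} [MetricSpace M] [Fintype M] {k : ℕ} (hk : 0 < k) {T : ℝ} (hT : 0 ≤ T)
    (x y : M) : ∃ r, 0 ≤ r ∧ r ≤ T ∧
      (r < T → k ≤ (Finset.univ.filter fun z => dist x z ≤ r).card ∧
        k ≤ (Finset.univ.filter fun z => dist y z ≤ r).card) ∧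
      (r = 0 ∨ (Finset.univ.filter fun z => dist x z < r).card < k ∨
        (Finset.univ.filter fun z => dist y z < r).card < k) := by
  obtain ⟨a, ha0, haT, ha, ha'⟩ := exists_radius_one hk hT x
  obtain ⟨b, hb0, hbT, hb, hb'⟩ := exists_radius_one hk hT y
  refine ⟨max a b, le_max_of_le_left ha0, max_le haT hbT, fun h => ⟨?_, ?_⟩, ?_⟩
  · exact (ha ((le_max_left _ _).trans_lt h)).trans (Finset.card_le_card fun z hz => by
      simp only [Finset.mem_filter, Finset.mem_univ, true_and] at hz ⊢
      exact hz.trans (le_max_left _ _))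
  · exact (hb ((le_max_right _ _).trans_lt h)).trans (Finset.card_le_card fun z hz => by
      simp only [Finset.mem_filter, Finset.mem_univ, true_and] at hz ⊢
      exact hz.trans (le_max_right _ _))
  · rcases le_total a b with h | h
    · rw [max_eq_right h]; exact hb'.imp id Or.inr
    · rw [max_eq_left h]; exact ha'.imp id Or.inl

/-- The contribution of one scale: if the open ball at `x` of radius `r` has at most `2 k` points and
the closed ball at `y` of radius `s` has at least `k`, then the distances of `x` and `y` to the union
of `A` and a random set of density `1 / (2 k)` differ by at least `r - s` with probability at least `1 / 12`. -/
theorem sum_abs_infDist_ge {M : Type u} [MetricSpace M] [Fintype M] [DecidableEq M] {k q : ℕ} [NeZero q] (hk : 0 < k)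
    (hq : q = 2 * k) {A : Set M} (hA : A.Nonempty) {x y : M} {r s : ℝ} (hsr : s ≤ r)
    (hxy : r + s ≤ dist x y) (hxA : r ≤ Metric.infDist x A)
    (hx : (Finset.univ.filter fun z => dist x z < r).card ≤ 2 * k)
    (hy : k ≤ (Finset.univ.filter fun z => dist y z ≤ s).card) :
    (r - s) / 12 ≤ ∑ g : M → Fin q, 1 / (q : ℝ) ^ Fintype.card M *
      |Metric.infDist x (A ∪ {z | g z = 0}) - Metric.infDist y (A ∪ {z | g z = 0})| := by
  have hdisj : Disjoint (Finset.univ.filter fun z => dist x z < r)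
      (Finset.univ.filter fun z => dist y z ≤ s) := by
    rw [Finset.disjoint_left]
    intro z h1 h2
    simp only [Finset.mem_filter, Finset.mem_univ, true_and] at h1 h2
    have := dist_triangle_right x y z
    linarith
  have hcard := card_miss_and_hit hk hq _ _ hx hy hdisj
  have hqpos : (0 : ℝ) < (q : ℝ) ^ Fintype.card M := by
    have : (0 : ℝ) < q := Nat.cast_pos.mpr (NeZero.pos q)
    positivity
  obtain ⟨G, hGcard, hG⟩ : ∃ G : Finset (M → Fin q), (q : ℝ) ^ Fintype.card M / 12 ≤ G.card ∧
      ∀ g ∈ G, (∀ z ∈ Finset.univ.filter fun z => dist x z < r, g z ≠ 0) ∧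
        ∃ z ∈ Finset.univ.filter fun z => dist y z ≤ s, g z = 0 :=
    ⟨_, hcard, fun g hg => (Finset.mem_filter.mp hg).2⟩
  have hlow : ∀ g ∈ G, r - s ≤
      |Metric.infDist x (A ∪ {z | g z = 0}) - Metric.infDist y (A ∪ {z | g z = 0})| := by
    intro g hg
    obtain ⟨h1, z, hz, hgz⟩ := hG g hg
    simp only [Finset.mem_filter, Finset.mem_univ, true_and] at h1 hz
    have h3 : r ≤ Metric.infDist x (A ∪ {z | g z = 0}) := by
      refine (Metric.le_infDist (hA.mono Set.subset_union_left)).mpr fun {w} hw => ?_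
      rcases hw with hw | hw
      · exact hxA.trans (Metric.infDist_le_dist_of_mem hw)
      · by_contra! hcon
        exact h1 w hcon hw
    have h4 : Metric.infDist y (A ∪ {z | g z = 0}) ≤ s :=
      (Metric.infDist_le_dist_of_mem (Set.mem_union_right A hgz)).trans hz
    exact le_trans (by linarith) (le_abs_self _)
  calc (r - s) / 12 = 1 / (q : ℝ) ^ Fintype.card M * ((q : ℝ) ^ Fintype.card M / 12 * (r - s)) := by
        field_simp
    _ ≤ 1 / (q : ℝ) ^ Fintype.card M * (G.card * (r - s)) := by
        refine mul_le_mul_of_nonneg_left (mul_le_mul_of_nonneg_right hGcard (by linarith)) ?_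
        positivity
    _ = ∑ g ∈ G, 1 / (q : ℝ) ^ Fintype.card M * (r - s) := by
        rw [Finset.sum_const, nsmul_eq_mul]; ring
    _ ≤ ∑ g ∈ G, 1 / (q : ℝ) ^ Fintype.card M *
        |Metric.infDist x (A ∪ {z | g z = 0}) - Metric.infDist y (A ∪ {z | g z = 0})| :=
        Finset.sum_le_sum fun g hg => mul_le_mul_of_nonneg_left (hlow g hg) (by positivity)
    _ ≤ _ := Finset.sum_le_sum_of_subset_of_nonneg (Finset.subset_univ _)
        fun g _ _ => by positivity

/-- Bourgain's telescoping sum over scales: `L` scales suffice when the ball of radius `T` about `x`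
has fewer than `2 ^ L` points. -/
theorem sum_scales_ge {M : Type u} [MetricSpace M] [Fintype M] [DecidableEq M] (L : ℕ) {A : Set M} (hA : A.Nonempty)
    {x y : M} {T : ℝ} (hT : 0 ≤ T) (hxy : 2 * T ≤ dist x y) (hxA : T ≤ Metric.infDist x A)
    (hyA : T ≤ Metric.infDist y A)
    (hx : (Finset.univ.filter fun z => dist x z < T).card < 2 ^ L) :
    T / 12 ≤ ∑ j : Fin L, ∑ g : M → Fin (2 ^ (j.val + 1)),
      1 / ((2 ^ (j.val + 1) : ℕ) : ℝ) ^ Fintype.card M *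
      |Metric.infDist x (A ∪ {z | g z = 0}) - Metric.infDist y (A ∪ {z | g z = 0})| := by
  choose r hr0 hrT hrge hrlt using fun j : ℕ => exists_radius (k := 2 ^ j) (by positivity) hT x y
  have hzero : r 0 = 0 := by
    by_contra hne
    have hpos : 0 < r 0 := lt_of_le_of_ne (hr0 0) (Ne.symm hne)
    rcases hrlt 0 with h | h | h
    · exact hne h
    · rw [pow_zero, Nat.lt_one_iff, Finset.card_eq_zero] at h
      have : x ∈ Finset.univ.filter fun z => dist x z < r 0 := by simpa using hpos
      rw [h] at this; exact absurd this (Finset.notMem_empty _)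
    · rw [pow_zero, Nat.lt_one_iff, Finset.card_eq_zero] at h
      have : y ∈ Finset.univ.filter fun z => dist y z < r 0 := by simpa using hpos
      rw [h] at this; exact absurd this (Finset.notMem_empty _)
  have htop : r L = T := by
    by_contra hne
    have hlt : r L < T := lt_of_le_of_ne (hrT L) hne
    have h1 := (hrge L hlt).1
    have h2 : (Finset.univ.filter fun z => dist x z ≤ r L).card ≤
        (Finset.univ.filter fun z => dist x z < T).card := Finset.card_le_card fun z hz => by
      simp only [Finset.mem_filter, Finset.mem_univ, true_and] at hz ⊢
      exact hz.trans_lt hlt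
    omega
  have hstep : ∀ j : ℕ, (r (j + 1) - r j) / 12 ≤ ∑ g : M → Fin (2 ^ (j + 1)),
      1 / ((2 ^ (j + 1) : ℕ) : ℝ) ^ Fintype.card M *
      |Metric.infDist x (A ∪ {z | g z = 0}) - Metric.infDist y (A ∪ {z | g z = 0})| := by
    intro j
    by_cases hj : r (j + 1) ≤ r j
    · refine le_trans (by linarith) (Finset.sum_nonneg fun g _ => by positivity)
    push Not at hj
    obtain ⟨hgx, hgy⟩ := hrge j (hj.trans_le (hrT _))
    have hq : 2 ^ (j + 1) = 2 * 2 ^ j := by ring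
    have hk : 0 < 2 ^ j := by positivity
    rcases hrlt (j + 1) with h | h | h
    · have := hr0 j; linarith
    · exact sum_abs_infDist_ge hk hq hA hj.le (by linarith [hrT j, hrT (j + 1)])
        ((hrT _).trans hxA) (by omega) hgy
    · have := sum_abs_infDist_ge hk hq hA (x := y) (y := x) hj.le
        (by rw [dist_comm]; linarith [hrT j, hrT (j + 1)]) ((hrT _).trans hyA) (by omega) hgx
      simp_rw [abs_sub_comm (Metric.infDist y _)] at this
      exact this
  calc T / 12 = ∑ j ∈ Finset.range L, (r (j + 1) - r j) / 12 := by
        rw [← Finset.sum_div, Finset.sum_range_sub, hzero, htop, sub_zero]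
    _ = ∑ j : Fin L, (r (j.val + 1) - r j.val) / 12 :=
        (Fin.sum_univ_eq_sum_range (fun j => (r (j + 1) - r j) / 12) L).symm
    _ ≤ _ := Finset.sum_le_sum fun j _ => hstep j.val

theorem card_quotientBySet {M : Type u} [Fintype M] [DecidableEq M] {A : Finset M}
    (hA : A.Nonempty) :
    Nat.card (QuotientBySet (A : Set M)) + A.card = Fintype.card M + 1 := by
  obtain ⟨a, ha⟩ := hA
  let φ : Option {x // x ∉ A} → QuotientBySet (A : Set M) := fun o =>
    o.elim (Quotient.mk (collapseSetoid (A : Set M)) a)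
      fun x => Quotient.mk (collapseSetoid (A : Set M)) x.1
  have hrel : ∀ x y : M, Quotient.mk (collapseSetoid (A : Set M)) x =
      Quotient.mk (collapseSetoid (A : Set M)) y ↔ x = y ∨ (x ∈ A ∧ y ∈ A) := fun x y =>
    Quotient.eq
  have hφ : Function.Bijective φ := by
    constructor
    · rintro (_ | x) (_ | y) h
      · rfl
      · rcases (hrel _ _).mp h with h | h
        exacts [absurd (h ▸ ha) y.2, absurd h.2 y.2]
      · rcases (hrel _ _).mp h with h | h
        exacts [absurd (h ▸ ha) x.2, absurd h.1 x.2]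
      · rcases (hrel _ _).mp h with h | h
        exacts [congrArg some (Subtype.ext h), absurd h.1 x.2]
    · intro U
      obtain ⟨x, rfl⟩ := Quotient.exists_rep U
      by_cases hx : x ∈ A
      · exact ⟨none, (hrel _ _).mpr (Or.inr ⟨ha, hx⟩)⟩
      · exact ⟨some ⟨x, hx⟩, rfl⟩
  rw [← Nat.card_congr (Equiv.ofBijective φ hφ), Nat.card_eq_fintype_card, Fintype.card_option,
    Fintype.card_subtype_compl, Fintype.card_coe]
  have := A.card_le_univ
  omega

/-- If `A` cuts off the balls with `2 ^ L` points at every point, then `M / A` embeds in `ℓ₂` with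
distortion `O(L)`: only `L` scales of Bourgain's embedding are needed below the distance to `A`, and
one coordinate, the distance to `A`, takes care of the rest. -/
theorem euclideanDistortion_quotientBySet_le {M : Type u} [MetricSpace M] [Finite M] (L : ℕ)
    {A : Set M} (hA : A.Nonempty)
    (hball : ∀ x : M, {z | 2 * dist x z < Metric.infDist x A}.ncard < 2 ^ L) :
    euclideanDistortion (QuotientBySet A) ≤ ENNReal.ofReal (96 * (L + 1)) := by
  classical
  have := Fintype.ofFinite M
  let ι := Option (Σ j : Fin L, (M → Fin (2 ^ (j.val + 1))))
  let w : ι → ℝ := fun o => o.elim 1 fun p => 1 / ((2 ^ (p.1.val + 1) : ℕ) : ℝ) ^ Fintype.card M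
  let S : ι → Set M := fun o => o.elim A fun p => A ∪ {z | p.2 z = 0}
  have hAS : ∀ i, A ⊆ S i := by
    rintro (_ | p)
    exacts [subset_rfl, Set.subset_union_left]
  have hinv : ∀ i x y, collapseSetoid A x y → Metric.infDist x (S i) = Metric.infDist y (S i) := by
    rintro i x y (rfl | ⟨hx, hy⟩)
    · rfl
    · rw [Metric.infDist_zero_of_mem (hAS i hx), Metric.infDist_zero_of_mem (hAS i hy)]
  let F : ι → QuotientBySet A → ℝ := fun i =>
    Quotient.lift (fun x => Metric.infDist x (S i)) (hinv i)
  have hW : ∑ i, w i = L + 1 := by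
    rw [Fintype.sum_option, Fintype.sum_sigma]
    have : ∀ j : Fin L, ∑ g : M → Fin (2 ^ (j.val + 1)), w (some ⟨j, g⟩) = 1 := by
      intro j
      simp only [w, Option.elim, Finset.sum_const, Finset.card_univ, Fintype.card_fun,
        Fintype.card_fin, nsmul_eq_mul]
      push_cast
      field_simp
    simp_rw [this]
    simp [w, add_comm]
  have hlip : ∀ i x y, |Metric.infDist x (S i) - Metric.infDist y (S i)| ≤ dist x y := by
    intro i x y
    rw [abs_le]
    have h1 := Metric.infDist_le_infDist_add_dist (s := S i) (x := x) (y := y)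
    have h2 := Metric.infDist_le_infDist_add_dist (s := S i) (x := y) (y := x)
    rw [dist_comm y x] at h2
    constructor <;> linarith
  have hw : ∀ i, 0 ≤ w i := by
    rintro (_ | p)
    · exact zero_le_one
    · simp only [w, Option.elim]; positivity
  have hmain := euclideanDistortion_le_of_weighted (X := QuotientBySet A) w hw F
    (c := 1 / 96) (by norm_num) ?_ ?_
  · rw [hW] at hmain
    refine hmain.trans_eq (congrArg _ ?_)
    ring
  · intro i U V
    obtain ⟨x, rfl⟩ := Quotient.exists_rep U
    obtain ⟨y, rfl⟩ := Quotient.exists_rep V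
    exact abs_sub_le_geoDist (collapseSetoid A) _ (hlip i) (hinv i) x y
  · intro U V
    obtain ⟨x, rfl⟩ := Quotient.exists_rep U
    obtain ⟨y, rfl⟩ := Quotient.exists_rep V
    set R := dist (α := QuotientBySet A) (Quotient.mk _ x) (Quotient.mk _ y)
    have hR0 : 0 ≤ R := dist_nonneg
    have hRd : R ≤ dist x y := geoDist_mk_le_dist (collapseSetoid A) x y
    have hRA : R ≤ Metric.infDist x A + Metric.infDist y A := by
      obtain ⟨a, ha, hxa⟩ := A.toFinite.isCompact.exists_infDist_eq_dist hA x
      obtain ⟨b, hb, hyb⟩ := A.toFinite.isCompact.exists_infDist_eq_dist hA y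
      have hab : (Quotient.mk (collapseSetoid A) a) = Quotient.mk _ b :=
        Quotient.sound (Or.inr ⟨ha, hb⟩)
      have h1 := geoDist_triangle (collapseSetoid A) (Quotient.mk _ x) (Quotient.mk _ a)
        (Quotient.mk _ y)
      have h2 := geoDist_mk_le_dist (collapseSetoid A) x a
      have h3 := geoDist_mk_le_dist (collapseSetoid A) b y
      rw [← hab] at h3
      rw [hxa, hyb, dist_comm y b]
      exact h1.trans (add_le_add h2 h3)
    have hsum : ∑ i, w i * |F i (Quotient.mk _ x) - F i (Quotient.mk _ y)| =
        |Metric.infDist x A - Metric.infDist y A| +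
        ∑ j : Fin L, ∑ g : M → Fin (2 ^ (j.val + 1)),
          1 / ((2 ^ (j.val + 1) : ℕ) : ℝ) ^ Fintype.card M *
          |Metric.infDist x (A ∪ {z | g z = 0}) - Metric.infDist y (A ∪ {z | g z = 0})| := by
      rw [Fintype.sum_option, Fintype.sum_sigma]
      simp only [w, F, S, Option.elim, one_mul]
      rfl
    rw [hsum]
    have hnn : 0 ≤ ∑ j : Fin L, ∑ g : M → Fin (2 ^ (j.val + 1)),
          1 / ((2 ^ (j.val + 1) : ℕ) : ℝ) ^ Fintype.card M *
          |Metric.infDist x (A ∪ {z | g z = 0}) - Metric.infDist y (A ∪ {z | g z = 0})| :=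
      Finset.sum_nonneg fun j _ => Finset.sum_nonneg fun g _ => by positivity
    by_cases hcase : R / 4 ≤ |Metric.infDist x A - Metric.infDist y A|
    · linarith
    -- both points are now at distance at least `R / 4` from `A`
    push Not at hcase
    obtain ⟨h1, h2⟩ := abs_lt.mp hcase
    have hcard : (Finset.univ.filter fun u => dist x u < R / 8).card < 2 ^ L := by
      refine lt_of_le_of_lt ?_ (hball x)
      rw [Set.ncard_eq_toFinset_card']
      refine Finset.card_le_card fun u hu => ?_
      simp only [Finset.mem_filter, Finset.mem_univ, true_and, Set.mem_toFinset,
        Set.mem_ofPred_eq] at hu ⊢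
      linarith
    have := sum_scales_ge L hA (x := x) (y := y) (T := R / 8) (by linarith) (by linarith)
      (by linarith) (by linarith) hcard
    have := abs_nonneg (Metric.infDist x A - Metric.infDist y A)
    linarith

/-- For every `ε` there is a set `A` for which `M / A` has `⌈(1 - ε) n⌉` points and Euclidean distortion
at most `400 log (2 / ε)`. -/
theorem exists_quotientBySet_euclideanDistortion_le {ε : ℝ} (hε : 0 < ε) (hε1 : ε < 1)
    (M : Type u) [MetricSpace M] [Finite M] :
    ∃ A : Set M, Nat.card (QuotientBySet A) = ⌈(1 - ε) * (Nat.card M : ℝ)⌉₊ ∧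
      euclideanDistortion (QuotientBySet A) ≤ ENNReal.ofReal (400 * Real.log (2 / ε)) := by
  classical
  have := Fintype.ofFinite M
  rw [Nat.card_eq_fintype_card (α := M)]
  set n := Fintype.card M with hn
  rcases isEmpty_or_nonempty M with hM | hM
  · have : IsEmpty (QuotientBySet (∅ : Set M)) := ⟨fun U => by
      obtain ⟨x, -⟩ := Quotient.exists_rep U
      exact hM.false x⟩
    refine ⟨∅, by simp [hn], ?_⟩
    refine (iInf_le _ ⟨fun U => isEmptyElim U, fun U => isEmptyElim U⟩).trans ?_
    refine (mapDistortion_le _ le_rfl le_rfl (fun U => isEmptyElim U)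
      (fun U => isEmptyElim U)).trans ?_
    simp
  have hnpos : (0 : ℝ) < n := by exact_mod_cast Fintype.card_pos
  set L := ⌈Real.logb 2 (1 / ε)⌉₊
  have hlog2 : 0 < Real.log 2 := Real.log_pos (by norm_num)
  have hlogb0 : 0 ≤ Real.logb 2 (1 / ε) :=
    Real.logb_nonneg (by norm_num) (by rw [le_div_iff₀ hε]; linarith)
  have h2L : 1 / ε ≤ 2 ^ L := by
    rw [← Real.rpow_natCast, ← Real.logb_le_iff_le_rpow (by norm_num) (by positivity)]
    exact Nat.le_ceil _
  have hLle : (L : ℝ) + 1 ≤ 2 * (Real.log (2 / ε) / Real.log 2) := by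
    have h1 : (L : ℝ) < Real.logb 2 (1 / ε) + 1 := Nat.ceil_lt_add_one hlogb0
    have h2 : Real.log (2 / ε) / Real.log 2 = 1 + Real.logb 2 (1 / ε) := by
      rw [Real.logb, div_eq_mul_one_div 2 ε, Real.log_mul (by norm_num) (by positivity)]
      field_simp
    rw [h2]; linarith
  obtain ⟨A₀, hA₀card, hA₀⟩ := exists_net (M := M) (m := 2 ^ L) (by positivity)
  have hA₀le : A₀.card ≤ ⌊ε * n⌋₊ := by
    refine Nat.le_floor ?_
    have h1 : (A₀.card : ℝ) * 2 ^ L ≤ n := by exact_mod_cast hA₀card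
    have h2 : (A₀.card : ℝ) * (1 / ε) ≤ n :=
      (mul_le_mul_of_nonneg_left h2L (Nat.cast_nonneg _)).trans h1
    rw [mul_one_div, div_le_iff₀ hε] at h2
    linarith
  have hfloor : ⌊ε * n⌋₊ < n := by
    rw [Nat.floor_lt (by positivity)]
    nlinarith
  obtain ⟨A, hA₀A, -, hAcard⟩ := Finset.exists_subsuperset_card_eq (Finset.subset_univ A₀)
    (n := ⌊ε * n⌋₊ + 1) (by omega) (by rw [Finset.card_univ]; omega)
  have hAne : A.Nonempty := Finset.card_pos.mp (by omega)
  refine ⟨A, ?_, ?_⟩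
  · have h1 := card_quotientBySet hAne
    have h2 : Nat.card (QuotientBySet (A : Set M)) = n - ⌊ε * n⌋₊ := by omega
    rw [h2, eq_comm, Nat.ceil_eq_iff (by omega), Nat.cast_sub hfloor.le]
    have h3 := Nat.floor_le (a := ε * n) (by positivity)
    have h4 := Nat.lt_floor_add_one (ε * n)
    have h5 : ((n - ⌊ε * n⌋₊ - 1 : ℕ) : ℝ) = n - ⌊ε * n⌋₊ - 1 := by
      rw [Nat.cast_sub (by omega), Nat.cast_sub hfloor.le, Nat.cast_one]
    rw [h5]
    constructor <;> linarith
  · refine (euclideanDistortion_quotientBySet_le L (by exact_mod_cast hAne) fun x => ?_).trans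
      (ENNReal.ofReal_le_ofReal ?_)
    · rw [Set.ncard_eq_toFinset_card']
      refine lt_of_le_of_lt (Finset.card_le_card fun z hz => ?_)
        (hA₀ A (by exact_mod_cast hA₀A) x)
      simpa using hz
    · have h3 : Real.log (2 / ε) / Real.log 2 ≤ 2 * Real.log (2 / ε) := by
        have : 0 ≤ Real.log (2 / ε) := Real.log_nonneg (by rw [le_div_iff₀ hε]; linarith)
        rw [div_le_iff₀ hlog2]
        nlinarith [Real.log_two_gt_d9]
      linarith

/-! ### Characters of `𝔽₂ᵐ` -/

/-- The nontrivial character of `ZMod 2`, with values `±1`. -/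
def zmodTwoSign (t : ZMod 2) : ℝ := if t = 0 then 1 else -1

theorem zmodTwoSign_add : ∀ s t : ZMod 2, zmodTwoSign (s + t) = zmodTwoSign s * zmodTwoSign t := by
  have h01 : ∀ t : ZMod 2, t = 0 ∨ t = 1 := by decide
  have h11 : (1 + 1 : ZMod 2) = 0 := rfl
  intro s t
  rcases h01 s with rfl | rfl <;> rcases h01 t with rfl | rfl <;> simp [zmodTwoSign, h11]

theorem zmodTwoSign_mul_self (t : ZMod 2) : zmodTwoSign t * zmodTwoSign t = 1 := by
  unfold zmodTwoSign; split_ifs <;> norm_num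

/-- The real character `x ↦ (-1) ^ (a ⬝ x)` of `𝔽₂ᵐ`. -/
def bitChar {m : ℕ} (a x : Fin m → ZMod 2) : ℝ := zmodTwoSign (a ⬝ᵥ x)

theorem bitChar_add {m : ℕ} (a x y : Fin m → ZMod 2) :
    bitChar a (x + y) = bitChar a x * bitChar a y := by
  unfold bitChar; rw [dotProduct_add, zmodTwoSign_add]

theorem bitChar_comm {m : ℕ} (a x : Fin m → ZMod 2) : bitChar a x = bitChar x a := by
  unfold bitChar; rw [dotProduct_comm]

theorem bitChar_mul_self {m : ℕ} (a x : Fin m → ZMod 2) : bitChar a x * bitChar a x = 1 :=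
  zmodTwoSign_mul_self _

theorem sum_bitChar {m : ℕ} (a : Fin m → ZMod 2) :
    ∑ x, bitChar a x = if a = 0 then (2 : ℝ) ^ m else 0 := by
  split_ifs with h
  · subst h
    simp [bitChar, zmodTwoSign, ZMod.card]
  · obtain ⟨i, hi⟩ := Function.ne_iff.mp h
    have h1 : bitChar a (Pi.single i 1) = -1 := by
      simp only [bitChar, dotProduct_single, mul_one, zmodTwoSign]
      exact if_neg hi
    have h2 : ∑ x, bitChar a x = ∑ x, bitChar a (x + Pi.single i 1) :=
      (Equiv.sum_comp (Equiv.addRight (Pi.single i 1)) (bitChar a)).symm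
    simp_rw [bitChar_add, h1, mul_neg_one, Finset.sum_neg_distrib] at h2
    linarith

theorem sub_eq_add_bits {m : ℕ} (x y : Fin m → ZMod 2) : x - y = x + y := by
  funext i; exact CharTwo.sub_eq_add _ _

section Fourier

variable {H : Type*} [NormedAddCommGroup H] [InnerProductSpace ℝ H] {m : ℕ}

theorem parseval_bits (f : (Fin m → ZMod 2) → H) :
    ∑ a, ‖∑ x, bitChar a x • f x‖ ^ 2 = 2 ^ m * ∑ x, ‖f x‖ ^ 2 := by
  have h1 : ∀ a, ‖∑ x, bitChar a x • f x‖ ^ 2 =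
      ∑ x, ∑ y, bitChar (x + y) a * inner ℝ (f x) (f y) := by
    intro a
    rw [← real_inner_self_eq_norm_sq, sum_inner]
    refine Finset.sum_congr rfl fun x _ => ?_
    rw [inner_sum]
    refine Finset.sum_congr rfl fun y _ => ?_
    rw [real_inner_smul_left, real_inner_smul_right, bitChar_comm (x + y), bitChar_add]
    ring
  simp_rw [h1]
  rw [Finset.sum_comm, Finset.mul_sum]
  refine Finset.sum_congr rfl fun x _ => ?_
  rw [Finset.sum_comm]
  simp_rw [← Finset.sum_mul, sum_bitChar]
  rw [Finset.sum_eq_single x]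
  · rw [← sub_eq_add_bits, sub_self, if_pos rfl, real_inner_self_eq_norm_sq]
  · intro y _ hy
    rw [← sub_eq_add_bits, if_neg (sub_ne_zero.mpr (Ne.symm hy)), zero_mul]
  · exact fun h => absurd (Finset.mem_univ _) h

/-- Parseval's identity for the increment `f (· + s) - f`, whose Fourier coefficient at `a` is that of
`f` times `bitChar a s - 1`. -/
theorem sum_norm_translate_sub_sq (f : (Fin m → ZMod 2) → H) (s : Fin m → ZMod 2) :
    2 ^ m * ∑ x, ‖f (x + s) - f x‖ ^ 2 =
      ∑ a, (2 - 2 * bitChar a s) * ‖∑ x, bitChar a x • f x‖ ^ 2 := by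
  rw [← parseval_bits fun x => f (x + s) - f x]
  refine Finset.sum_congr rfl fun a _ => ?_
  have h1 : ∑ x, bitChar a x • f (x + s) = bitChar a s • ∑ x, bitChar a x • f x := by
    rw [← Equiv.sum_comp (Equiv.addRight s) (fun x => bitChar a x • f x), Finset.smul_sum]
    refine Finset.sum_congr rfl fun x _ => ?_
    rw [Equiv.coe_addRight, bitChar_add, smul_smul, mul_comm (bitChar a s), mul_assoc,
      bitChar_mul_self, mul_one]
  simp_rw [smul_sub]
  rw [Finset.sum_sub_distrib, h1]
  have h2 : bitChar a s • (∑ x, bitChar a x • f x) - ∑ x, bitChar a x • f x =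
      (bitChar a s - 1) • ∑ x, bitChar a x • f x := by rw [sub_smul, one_smul]
  rw [h2, norm_smul, mul_pow, Real.norm_eq_abs, sq_abs]
  congr 1
  have := bitChar_mul_self a s
  linear_combination this

/-- The Poincaré inequality of a Cayley graph of `𝔽₂ᵐ` all of whose nontrivial characters are `-1`
on at least `k` of the generators. -/
theorem poincare_bits {d k : ℕ} (s : Fin d → Fin m → ZMod 2)
    (hs : ∀ a : Fin m → ZMod 2, a ≠ 0 → k ≤ (Finset.univ.filter fun i => a ⬝ᵥ s i ≠ 0).card)
    (f : (Fin m → ZMod 2) → H) :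
    2 * k * ∑ z, ∑ x, ‖f (x + z) - f x‖ ^ 2 ≤ 2 ^ m * ∑ i, ∑ x, ‖f (x + s i) - f x‖ ^ 2 := by
  set N : (Fin m → ZMod 2) → ℝ := fun a => ‖∑ x, bitChar a x • f x‖ ^ 2 with hN
  have hN0 : ∀ a, 0 ≤ N a := fun a => by positivity
  have h1 : 2 ^ m * ∑ i, ∑ x, ‖f (x + s i) - f x‖ ^ 2 =
      ∑ a, 4 * ((Finset.univ.filter fun i => a ⬝ᵥ s i ≠ 0).card : ℝ) * N a := by
    rw [Finset.mul_sum]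
    simp_rw [sum_norm_translate_sub_sq]
    rw [Finset.sum_comm]
    refine Finset.sum_congr rfl fun a _ => ?_
    rw [← Finset.sum_mul]
    congr 1
    rw [Finset.card_filter, Nat.cast_sum, Finset.mul_sum]
    refine Finset.sum_congr rfl fun i _ => ?_
    simp only [bitChar, zmodTwoSign]
    split_ifs <;> simp_all; norm_num
  have h2 : 2 ^ m * ∑ z, ∑ x, ‖f (x + z) - f x‖ ^ 2 =
      2 ^ m * ∑ a, (if a = 0 then 0 else 2) * N a := by
    rw [Finset.mul_sum]
    simp_rw [sum_norm_translate_sub_sq]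
    rw [Finset.sum_comm, Finset.mul_sum]
    refine Finset.sum_congr rfl fun a _ => ?_
    rw [← Finset.sum_mul, Finset.sum_sub_distrib, ← Finset.mul_sum, sum_bitChar, ← mul_assoc]
    congr 1
    split_ifs <;> simp [ZMod.card]
    ring
  have h2' := mul_left_cancel₀ (by positivity) h2
  rw [h1, h2', Finset.mul_sum]
  refine Finset.sum_le_sum fun a _ => ?_
  rw [← mul_assoc]
  refine mul_le_mul_of_nonneg_right ?_ (hN0 a)
  split_ifs with ha
  · simp
  · have : (k : ℝ) ≤ (Finset.univ.filter fun i => a ⬝ᵥ s i ≠ 0).card := by exact_mod_cast hs a ha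
    linarith

end Fourier

/-! ### Random generators of `𝔽₂ᵐ` -/

theorem prod_ite_pow {d : ℕ} (p : Fin d → Prop) [DecidablePred p] (t : ℝ) :
    ∏ i, (if p i then t else 1) = t ^ (Finset.univ.filter p).card := by
  rw [Finset.prod_ite, Finset.prod_const, Finset.prod_const_one, mul_one]

/-- Some `8 m` vectors of `𝔽₂ᵐ` have the property that each nontrivial character is `-1` on more
than `m` of them. For a random choice, `(1 / 4) ^ N` has expectation `(5 / 8) ^ (8 m)` for each
character, where `N` is the number of values `-1`, and `2 ^ m * (5 / 8) ^ (8 m) < (1 / 4) ^ m`. -/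
theorem exists_expanding_generators {m : ℕ} (hm : 0 < m) :
    ∃ s : Fin (8 * m) → Fin m → ZMod 2, ∀ a : Fin m → ZMod 2, a ≠ 0 →
      m ≤ (Finset.univ.filter fun i => a ⬝ᵥ s i ≠ 0).card := by
  by_contra! hcon
  set h : (Fin m → ZMod 2) → (Fin m → ZMod 2) → ℝ := fun a v => if a ⬝ᵥ v ≠ 0 then 1 / 4 else 1
    with hh
  have hsum : ∀ a, a ≠ 0 → ∑ v, h a v = 5 / 8 * 2 ^ m := by
    intro a ha
    have h1 : ∀ v, h a v = 5 / 8 + 3 / 8 * bitChar a v := by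
      intro v
      simp only [hh, bitChar, zmodTwoSign]
      split_ifs <;> simp_all <;> norm_num
    simp_rw [h1]
    rw [Finset.sum_add_distrib, ← Finset.mul_sum, sum_bitChar, if_neg ha]
    simp [ZMod.card, mul_comm]
  have hh0 : ∀ a v, 0 ≤ h a v := by
    intro a v; simp only [hh]; split_ifs <;> norm_num
  have hlow : ∀ s : Fin (8 * m) → Fin m → ZMod 2,
      (1 / 4 : ℝ) ^ m ≤ ∑ a ∈ Finset.univ.filter (fun a : Fin m → ZMod 2 => a ≠ 0),
        ∏ i, h a (s i) := by
    intro s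
    obtain ⟨a, ha, hlt⟩ := hcon s
    refine le_trans ?_ (Finset.single_le_sum (f := fun a => ∏ i, h a (s i))
      (fun b _ => Finset.prod_nonneg fun i _ => hh0 b _)
      (Finset.mem_filter.mpr ⟨Finset.mem_univ a, ha⟩))
    simp only [hh]
    rw [prod_ite_pow]
    exact pow_le_pow_of_le_one (by norm_num) (by norm_num) hlt.le
  have htot := Finset.sum_le_sum fun s (_ : s ∈ Finset.univ) => hlow s
  rw [Finset.sum_comm] at htot
  have hup : ∑ a ∈ Finset.univ.filter (fun a : Fin m → ZMod 2 => a ≠ 0),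
      ∑ s : Fin (8 * m) → Fin m → ZMod 2, ∏ i, h a (s i) ≤
      2 ^ m * (5 / 8 * 2 ^ m) ^ (8 * m) := by
    calc _ = ∑ a ∈ Finset.univ.filter (fun a : Fin m → ZMod 2 => a ≠ 0),
          (5 / 8 * (2 : ℝ) ^ m) ^ (8 * m) := by
          refine Finset.sum_congr rfl fun a ha => ?_
          rw [← Fintype.sum_pow, hsum a (Finset.mem_filter.mp ha).2]
      _ ≤ _ := by
          rw [Finset.sum_const, nsmul_eq_mul]
          refine mul_le_mul_of_nonneg_right ?_ (by positivity)
          have : (Finset.univ.filter (fun a : Fin m → ZMod 2 => a ≠ 0)).card ≤ 2 ^ m :=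
            (Finset.card_le_univ _).trans_eq (by simp [ZMod.card])
          exact_mod_cast this
  have h3 := htot.trans hup
  rw [Finset.sum_const, Finset.card_univ, nsmul_eq_mul] at h3
  simp only [Fintype.card_fun, ZMod.card, Fintype.card_fin] at h3
  push_cast at h3
  have h4 : ((2 : ℝ) ^ m) ^ (8 * m) * (1 / 4) ^ m ≤
      ((2 : ℝ) ^ m) ^ (8 * m) * (2 * (5 / 8) ^ 8) ^ m := by
    refine h3.trans_eq ?_
    rw [mul_pow (5 / 8 : ℝ), mul_pow (2 : ℝ) ((5 / 8) ^ 8), ← pow_mul (5 / 8 : ℝ)]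
    ring
  have h5 := le_of_mul_le_mul_left h4 (by positivity)
  exact absurd h5 (not_le.mpr (pow_lt_pow_left₀ (by norm_num) (by norm_num) hm.ne'))

/-! ### A Cayley graph of large Euclidean distortion -/

/-- The word norm of `v ∈ 𝔽₂ᵐ` with respect to the generators `s`, truncated at `l + 1`. Words are
encoded as vectors of coefficients; in characteristic two no generator is needed twice. The
truncation makes the norm finite without a spanning assumption on `s`. -/
noncomputable def wordNorm {m d : ℕ} (s : Fin d → Fin m → ZMod 2) (l : ℕ) (v : Fin m → ZMod 2) : ℕ :=
  sInf {k | l + 1 ≤ k ∨ ∃ c : Fin d → ZMod 2, hammingNorm c ≤ k ∧ ∑ i, c i • s i = v}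

section WordNorm

variable {m d : ℕ} (s : Fin d → Fin m → ZMod 2) (l : ℕ)

theorem wordNorm_mem (v : Fin m → ZMod 2) : l + 1 ≤ wordNorm s l v ∨
    ∃ c : Fin d → ZMod 2, hammingNorm c ≤ wordNorm s l v ∧ ∑ i, c i • s i = v :=
  Nat.sInf_mem (s := {k | l + 1 ≤ k ∨ ∃ c : Fin d → ZMod 2, hammingNorm c ≤ k ∧
    ∑ i, c i • s i = v}) ⟨l + 1, Or.inl le_rfl⟩

theorem wordNorm_le_succ (v : Fin m → ZMod 2) : wordNorm s l v ≤ l + 1 :=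
  Nat.sInf_le (Or.inl le_rfl)

theorem wordNorm_sum_le (c : Fin d → ZMod 2) : wordNorm s l (∑ i, c i • s i) ≤ hammingNorm c :=
  Nat.sInf_le (Or.inr ⟨c, le_rfl, rfl⟩)

theorem wordNorm_zero : wordNorm s l 0 = 0 := by
  have := wordNorm_sum_le s l 0
  simpa using this

theorem wordNorm_generator_le (i : Fin d) : wordNorm s l (s i) ≤ 1 := by
  have := wordNorm_sum_le s l (Pi.single i 1)
  have h1 : ∑ j, (Pi.single i 1 : Fin d → ZMod 2) j • s j = s i := by
    rw [Finset.sum_eq_single i] <;> simp +contextual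
  rw [h1] at this
  refine this.trans ?_
  rw [hammingNorm]
  refine Finset.card_le_one.mpr fun a ha b hb => ?_
  simp only [Finset.mem_filter, Finset.mem_univ, true_and, Pi.single_apply, ne_eq,
    ite_eq_right_iff, Classical.not_imp] at ha hb
  rw [ha.1, hb.1]

theorem eq_zero_of_wordNorm_eq_zero {v : Fin m → ZMod 2} (h : wordNorm s l v = 0) : v = 0 := by
  rcases wordNorm_mem s l v with h1 | ⟨c, hc, rfl⟩
  · omega
  · rw [h, Nat.le_zero, hammingNorm_eq_zero] at hc
    simp [hc]

theorem wordNorm_add_le (v w : Fin m → ZMod 2) :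
    wordNorm s l (v + w) ≤ wordNorm s l v + wordNorm s l w := by
  rcases wordNorm_mem s l v with h1 | ⟨c, hc, hcv⟩
  · exact (wordNorm_le_succ s l _).trans (by omega)
  rcases wordNorm_mem s l w with h2 | ⟨c', hc', hcw⟩
  · exact (wordNorm_le_succ s l _).trans (by omega)
  have h3 := wordNorm_sum_le s l (c + c')
  simp only [Pi.add_apply, add_smul, Finset.sum_add_distrib, hcv, hcw] at h3
  have h4 : hammingNorm (c + c') ≤ hammingNorm c + hammingNorm c' := by
    have := hammingDist_triangle c 0 c'
    rw [hammingDist_zero_right, hammingDist_zero_left, hammingDist_eq_hammingNorm] at this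
    rwa [show -c = c from funext fun i => CharTwo.neg_eq _] at this
  omega

/-- The exponential moment bound for the number of vectors that are sums of at most `l` generators. -/
theorem card_wordNorm_le (l : ℕ) {t : ℝ} (ht : 0 < t) (ht1 : t ≤ 1) :
    t ^ l * ((Finset.univ.filter fun v => wordNorm s l v ≤ l).card : ℝ) ≤ (1 + t) ^ d := by
  classical
  set C : Finset (Fin d → ZMod 2) := Finset.univ.filter fun c => hammingNorm c ≤ l with hC
  have h1 : (Finset.univ.filter fun v => wordNorm s l v ≤ l).card ≤ C.card := by
    refine (Finset.card_le_card (t := C.image fun c => ∑ i, c i • s i) fun v hv => ?_).trans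
      Finset.card_image_le
    have hv' := (Finset.mem_filter.mp hv).2
    rcases wordNorm_mem s l v with h | ⟨c, hc, rfl⟩
    · omega
    · exact Finset.mem_image.mpr ⟨c, Finset.mem_filter.mpr ⟨Finset.mem_univ _, hc.trans hv'⟩, rfl⟩
  have h2 : ∑ c : Fin d → ZMod 2, t ^ hammingNorm c = (1 + t) ^ d := by
    have h3 : ∑ b : ZMod 2, (if b ≠ 0 then t else 1) = 1 + t := by
      rw [show (Finset.univ : Finset (ZMod 2)) = {0, 1} from rfl]
      simp
    rw [← h3, Fintype.sum_pow]
    refine Finset.sum_congr rfl fun c _ => ?_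
    rw [prod_ite_pow]; rfl
  rw [← h2]
  calc t ^ l * ((Finset.univ.filter fun v => wordNorm s l v ≤ l).card : ℝ) ≤ t ^ l * C.card :=
        mul_le_mul_of_nonneg_left (by exact_mod_cast h1) (by positivity)
    _ = ∑ c ∈ C, t ^ l := by rw [Finset.sum_const, nsmul_eq_mul, mul_comm]
    _ ≤ ∑ c ∈ C, t ^ hammingNorm c := Finset.sum_le_sum fun c hc =>
        pow_le_pow_of_le_one ht.le ht1 (Finset.mem_filter.mp hc).2
    _ ≤ _ := Finset.sum_le_sum_of_subset_of_nonneg (Finset.subset_univ _)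
        fun c _ _ => by positivity

/-- The metric of the truncated word norm on `𝔽₂ᵐ`. -/
@[reducible] noncomputable def wordMetric : MetricSpace (Fin m → ZMod 2) where
  dist x y := wordNorm s l (x - y)
  dist_self x := by rw [sub_self, wordNorm_zero, Nat.cast_zero]
  dist_comm x y := by rw [sub_eq_add_bits, sub_eq_add_bits, add_comm]
  dist_triangle x y z := by
    rw [← sub_add_sub_cancel x y z]
    exact_mod_cast wordNorm_add_le s l _ _
  eq_of_dist_eq_zero h := sub_eq_zero.mp (eq_zero_of_wordNorm_eq_zero s l (by exact_mod_cast h))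

end WordNorm

/-- Metric spaces with `1024 ^ l` points, diameter at most `l + 1` and Euclidean distortion at least
`l / 3`. -/
theorem exists_metric_euclideanDistortion_ge {l : ℕ} (hl : 0 < l) :
    ∃ _ : MetricSpace (Fin (10 * l) → ZMod 2),
      (∀ x y : Fin (10 * l) → ZMod 2, dist x y ≤ l + 1) ∧
      ENNReal.ofReal (l / 3) ≤ euclideanDistortion (Fin (10 * l) → ZMod 2) := by
  obtain ⟨s, hs⟩ := exists_expanding_generators (m := 10 * l) (by omega)
  let _ := wordMetric s l
  have hd : ∀ x y : Fin (10 * l) → ZMod 2, dist x y = wordNorm s l (x - y) := fun _ _ => rfl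
  refine ⟨inferInstance, fun x y => by rw [hd]; exact_mod_cast wordNorm_le_succ s l _, ?_⟩
  have : Nonempty (Fin (10 * l)) := ⟨⟨0, by omega⟩⟩
  refine le_iInf fun f => le_mapDistortion f fun L K hL hK h1 h2 => ?_
  have hcard : (Fintype.card (Fin (10 * l) → ZMod 2) : ℝ) = 2 ^ (10 * l) := by simp [ZMod.card]
  -- at least half of all vectors have word norm `l + 1`
  have hbig : (2 : ℝ) ^ (10 * l) / 2 ≤ (Finset.univ.filter fun v => ¬ wordNorm s l v ≤ l).card := by
    have h3 := card_wordNorm_le s l (t := 1 / 32) (by norm_num) (by norm_num)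
    have h4 : ((Finset.univ.filter fun v => wordNorm s l v ≤ l).card : ℝ) +
        (Finset.univ.filter fun v => ¬ wordNorm s l v ≤ l).card = 2 ^ (10 * l) := by
      rw [← hcard]; exact_mod_cast Finset.card_filter_add_card_filter_not (s := Finset.univ) _
    set N : ℝ := ((Finset.univ.filter fun v => wordNorm s l v ≤ l).card : ℝ)
    have h5 : N ≤ 512 ^ l := by
      have h6 : N = 32 ^ l * ((1 / 32) ^ l * N) := by
        rw [← mul_assoc, ← mul_pow]; norm_num
      calc N ≤ 32 ^ l * (1 + 1 / 32) ^ (8 * (10 * l)) := by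
            rw [h6]; exact mul_le_mul_of_nonneg_left h3 (by positivity)
        _ = (32 * (33 / 32) ^ 80) ^ l := by
            rw [mul_pow, ← pow_mul]; norm_num [← mul_assoc]
        _ ≤ 512 ^ l := pow_le_pow_left₀ (by positivity) (by norm_num) l
    have h7 : (2 : ℝ) ^ (10 * l) = 512 ^ l * 2 ^ l := by
      rw [pow_mul, ← mul_pow]; norm_num
    have h8 : (2 : ℝ) ≤ 2 ^ l := le_self_pow₀ (by norm_num) hl.ne'
    have h9 : (512 : ℝ) ^ l * 2 ≤ 512 ^ l * 2 ^ l := by gcongr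
    linarith
  have hP := poincare_bits s hs f
  have hup : ∑ i, ∑ x, ‖f (x + s i) - f x‖ ^ 2 ≤ (8 * (10 * l) : ℝ) * (2 ^ (10 * l) * L ^ 2) := by
    have h5 : ∀ i x, ‖f (x + s i) - f x‖ ^ 2 ≤ L ^ 2 := by
      intro i x
      rw [← dist_eq_norm]
      refine pow_le_pow_left₀ dist_nonneg ((h1 _ _).trans ?_) 2
      rw [hd, add_sub_cancel_left]
      have : ((wordNorm s l (s i) : ℕ) : ℝ) ≤ 1 := by exact_mod_cast wordNorm_generator_le s l i
      nlinarith
    calc _ ≤ ∑ i : Fin (8 * (10 * l)), ∑ x : Fin (10 * l) → ZMod 2, L ^ 2 :=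
          Finset.sum_le_sum fun i _ => Finset.sum_le_sum fun x _ => h5 i x
      _ = _ := by
          simp only [Finset.sum_const, Finset.card_univ, nsmul_eq_mul, hcard, Fintype.card_fin]
          push_cast; ring
  have hdown : (2 : ℝ) ^ (10 * l) / 2 * (2 ^ (10 * l) * l ^ 2) ≤
      K ^ 2 * ∑ z, ∑ x, ‖f (x + z) - f x‖ ^ 2 := by
    have h6 : ∀ z ∈ Finset.univ.filter fun v => ¬ wordNorm s l v ≤ l, ∀ x : Fin (10 * l) → ZMod 2,
        (l : ℝ) ^ 2 ≤ K ^ 2 * ‖f (x + z) - f x‖ ^ 2 := by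
      intro z hz x
      rw [← mul_pow, ← dist_eq_norm]
      refine pow_le_pow_left₀ (by positivity) (le_trans ?_ (h2 _ _)) 2
      rw [hd, add_sub_cancel_left]
      have := (Finset.mem_filter.mp hz).2
      exact_mod_cast (by omega : l ≤ wordNorm s l z)
    calc _ ≤ ((Finset.univ.filter fun v => ¬ wordNorm s l v ≤ l).card : ℝ) *
            (2 ^ (10 * l) * l ^ 2) := mul_le_mul_of_nonneg_right hbig (by positivity)
      _ = ∑ z ∈ Finset.univ.filter fun v => ¬ wordNorm s l v ≤ l, ∑ x : Fin (10 * l) → ZMod 2, (l : ℝ) ^ 2 := by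
          simp only [Finset.sum_const, Finset.card_univ, nsmul_eq_mul, hcard]
      _ ≤ ∑ z ∈ Finset.univ.filter fun v => ¬ wordNorm s l v ≤ l,
            ∑ x : Fin (10 * l) → ZMod 2, K ^ 2 * ‖f (x + z) - f x‖ ^ 2 :=
          Finset.sum_le_sum fun z hz => Finset.sum_le_sum fun x _ => h6 z hz x
      _ ≤ ∑ z, ∑ x : Fin (10 * l) → ZMod 2, K ^ 2 * ‖f (x + z) - f x‖ ^ 2 :=
          Finset.sum_le_sum_of_subset_of_nonneg (Finset.subset_univ _)
            fun z _ _ => Finset.sum_nonneg fun x _ => by positivity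
      _ = _ := by simp_rw [← Finset.mul_sum]
  have hlpos : (0 : ℝ) < l := by exact_mod_cast hl
  set Q : ℝ := 2 ^ (10 * l) with hQ
  have hQpos : 0 < Q := by positivity
  set E := ∑ z, ∑ x, ‖f (x + z) - f x‖ ^ 2
  push_cast at hP
  have hS : E ≤ 4 * Q ^ 2 * L ^ 2 := by
    have h7 : 2 * (10 * (l : ℝ)) * E ≤ 2 * (10 * (l : ℝ)) * (4 * Q ^ 2 * L ^ 2) :=
      hP.trans ((mul_le_mul_of_nonneg_left hup hQpos.le).trans_eq (by ring))
    exact le_of_mul_le_mul_left h7 (by positivity)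
  have h8 : Q ^ 2 * (l : ℝ) ^ 2 ≤ Q ^ 2 * (8 * (L * K) ^ 2) := by
    nlinarith [mul_le_mul_of_nonneg_left hS (sq_nonneg K)]
  have h9 := le_of_mul_le_mul_left h8 (by positivity)
  refine le_of_sq_le_sq ?_ (by positivity)
  nlinarith [sq_nonneg (L * K)]

/-! ### Disjoint copies of a metric space -/

/-- The disjoint union of copies of `G` indexed by `ι`. It is not a plain product because it carries
another metric. -/
def Copies (ι : Type u) (G : Type v) : Type (max u v) := ι × G

/-- The metric on `Copies ι G` for which different copies are at distance `D`, an upper bound for the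
diameter of `G`. -/
@[reducible] noncomputable def copiesMetric (ι : Type u) (G : Type v) [DecidableEq ι] [MetricSpace G]
    {D : ℝ} (hD0 : 0 < D) (hD : ∀ x y : G, dist x y ≤ D) : MetricSpace (Copies ι G) where
  dist p q := if p.1 = q.1 then dist p.2 q.2 else D
  dist_self p := by simp
  dist_comm p q := by simp only [eq_comm (a := p.1), dist_comm p.2]
  dist_triangle p q r := by
    have h0 := dist_nonneg (x := p.2) (y := q.2)
    have h1 := dist_nonneg (x := q.2) (y := r.2)
    have h2 := hD p.2 r.2
    have h3 := dist_triangle p.2 q.2 r.2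
    split_ifs <;> first | linarith | simp_all
  eq_of_dist_eq_zero {p q} h := by
    split_ifs at h with h'
    · exact Prod.ext h' (dist_eq_zero.mp h)
    · exact absurd h hD0.ne'

/-- A part `G` of `X` that is far from its complement is not distorted by a quotient map all of whose
fibres over it are singletons: a path leaving `G` is at least as long as the diameter of `G`. -/
theorem isometry_mk_of_far {G : Type v} {X : Type u} [MetricSpace G] [MetricSpace X] [Finite X]
    (r : Setoid X) {e : G → X} (he : Isometry e) {D : ℝ} (hD : ∀ a b : G, dist a b ≤ D)
    (hfar : ∀ (g : G) (z : X), z ∉ Set.range e → D ≤ dist (e g) z)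
    (hsing : ∀ (g : G) (z : X), r (e g) z → z = e g) :
    Isometry (β := QSpace r) fun g => Quotient.mk r (e g) := by
  refine Isometry.of_dist_eq fun a b => le_antisymm ?_ ?_
  · exact (geoDist_mk_le_dist r (e a) (e b)).trans_eq (he.dist_eq a b)
  · -- the distance to `e a`, truncated at `D`, is constant on the parts
    have key := abs_sub_le_geoDist r (fun z => min (dist (e a) z) D) ?_ ?_ (e a) (e b)
    · rw [dist_self, he.dist_eq, min_eq_left (hD a b), min_eq_left (dist_nonneg.trans (hD a b)),
        zero_sub, abs_neg, abs_of_nonneg dist_nonneg] at key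
      exact key
    · intro x y
      refine (abs_min_sub_min_le_max _ _ _ _).trans ?_
      rw [sub_self, abs_zero, max_eq_left (abs_nonneg _), dist_comm (e a) x, dist_comm (e a) y]
      exact abs_dist_sub_le x y (e a)
    · intro x y hxy
      by_cases hx : x ∈ Set.range e
      · obtain ⟨g, rfl⟩ := hx
        rw [hsing g y hxy]
      by_cases hy : y ∈ Set.range e
      · obtain ⟨g, rfl⟩ := hy
        rw [hsing g x (r.symm' hxy)]
      · simp only [min_eq_right (hfar a x hx), min_eq_right (hfar a y hy)]

/-- Pigeonhole principle for a partial quotient map `κ` of `Y` onto `𝒰` with section `σ`: it loses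
`|Y| - |𝒰|` points, so if `Y` has more than twice as many fibres over `ι` then on one of these fibres
`κ` is defined and its classes are singletons. -/
theorem exists_intact_fiber {Y ι 𝒰 : Type*} [Finite Y] [Finite ι] (π : Y → ι) (κ : Y → Option 𝒰)
    (σ : 𝒰 → Y) (hσ : ∀ U, κ (σ U) = some U)
    (hcard : 2 * Nat.card Y < 2 * Nat.card 𝒰 + Nat.card ι) :
    ∃ i, ∀ y, π y = i → (∃ U, κ y = some U) ∧ ∀ z, κ z = κ y → z = y := by
  classical
  by_contra! hcon
  have hσinj : Function.Injective σ := fun U V h => by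
    have := hσ U
    rw [h, hσ V] at this
    exact (Option.some.inj this).symm
  -- in a bad fibre, either a point `b` outside the image of the section, or the representative `b` of a
  -- nontrivial class together with another point `n` of that class; `n` is outside the image
  have hwit : ∀ i, ∃ (b : Y) (n : {y // y ∉ Set.range σ}), π b = i ∧
      (b = n ∨ ∃ U, b = σ U ∧ κ n = some U) := by
    intro i
    obtain ⟨b, hb, h⟩ := hcon i
    by_cases hbr : b ∈ Set.range σ
    · obtain ⟨U, rfl⟩ := hbr
      obtain ⟨z, hz, hne⟩ := h ⟨U, hσ U⟩
      rw [hσ U] at hz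
      refine ⟨σ U, ⟨z, ?_⟩, hb, Or.inr ⟨U, rfl, hz⟩⟩
      rintro ⟨V, rfl⟩
      rw [hσ V] at hz
      exact hne (congrArg σ (Option.some.inj hz))
    · exact ⟨b, ⟨b, hbr⟩, hb, Or.inl rfl⟩
  choose b n hπ hbn using hwit
  let φ : ι → {y // y ∉ Set.range σ} × Bool := fun i => (n i, decide (b i = n i))
  have hφ : Function.Injective φ := by
    intro i j hij
    obtain ⟨h1, h2⟩ := Prod.mk.inj hij
    rw [← hπ i, ← hπ j]
    congr 1
    by_cases hi : b i = n i
    · have hj : b j = n j := by simpa [hi] using h2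
      rw [hi, hj, h1]
    · have hj : b j ≠ n j := by simpa [hi] using h2
      obtain ⟨U, hU, hU'⟩ := (hbn i).resolve_left hi
      obtain ⟨V, hV, hV'⟩ := (hbn j).resolve_left hj
      rw [h1, hV'] at hU'
      rw [hU, hV, Option.some.inj hU']
  have h1 := Nat.card_le_card_of_injective φ hφ
  rw [Nat.card_prod, Nat.card_eq_fintype_card (α := Bool), Fintype.card_bool] at h1
  have h2 : Nat.card {y // y ∉ Set.range σ} + Nat.card 𝒰 = Nat.card Y := by
    have h3 : Nat.card {y // y ∉ Set.range σ} = (Set.range σ)ᶜ.ncard := rfl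
    have h4 : Nat.card 𝒰 = (Set.range σ).ncard := Nat.card_congr (Equiv.ofInjective σ hσinj)
    rw [h3, h4, add_comm, Set.ncard_add_ncard_compl]
  omega

/-- A `QS` space of a union `Y` of copies of `G` that loses few points contains an intact copy. -/
theorem exists_isometry_qspace_subset {Y : Type u} {ι G : Type v} [MetricSpace Y] [Finite Y]
    [Finite ι] [MetricSpace G] (π : Y → ι) (e : ι → G → Y) (he : ∀ i, Isometry (e i))
    (hπ : ∀ i y, y ∈ Set.range (e i) ↔ π y = i) {D : ℝ} (hD : ∀ a b : G, dist a b ≤ D)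
    (hfar : ∀ x y, π x ≠ π y → D ≤ dist x y) (S : Set Y) (r : Setoid S)
    (hcard : 2 * Nat.card Y < 2 * Nat.card (QSpace r) + Nat.card ι) :
    ∃ φ : G → QSpace r, Isometry φ := by
  classical
  obtain ⟨i, hi⟩ := exists_intact_fiber π
    (fun y => if h : y ∈ S then some (Quotient.mk r ⟨y, h⟩) else none)
    (fun U : QSpace r => ((Quotient.out U : S) : Y)) (fun U => by
      rw [dif_pos (Quotient.out U).2]
      exact congrArg some (Quotient.out_eq U)) hcard
  have hpi : ∀ g, π (e i g) = i := fun g => (hπ i _).mp ⟨g, rfl⟩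
  have hS : ∀ g, e i g ∈ S := by
    intro g
    by_contra hg
    obtain ⟨U, hU⟩ := (hi _ (hpi g)).1
    simp [hg] at hU
  let e' : G → S := fun g => ⟨e i g, hS g⟩
  refine ⟨_, isometry_mk_of_far r (e := e') (Isometry.of_dist_eq fun a b => (he i).dist_eq a b) hD
    ?_ ?_⟩
  · intro g z hz
    refine hfar _ _ fun h => hz ?_
    obtain ⟨g', hg'⟩ := (hπ i z).mpr (h ▸ hpi g)
    exact ⟨g', Subtype.ext hg'⟩
  · intro g z hz
    refine Subtype.ext ((hi _ (hpi g)).2 z ?_)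
    simp only [dif_pos z.2, dif_pos (hS g)]
    exact congrArg some (Quotient.sound (r.symm' hz))

/-- An `SQ` space of a union `Y` of copies of `G` that loses few points contains an intact copy. -/
theorem exists_isometry_subset_qspace {Y : Type u} {ι G : Type v} [MetricSpace Y] [Finite Y]
    [Finite ι] [MetricSpace G] (π : Y → ι) (e : ι → G → Y) (he : ∀ i, Isometry (e i))
    (hπ : ∀ i y, y ∈ Set.range (e i) ↔ π y = i) {D : ℝ} (hD : ∀ a b : G, dist a b ≤ D)
    (hfar : ∀ x y, π x ≠ π y → D ≤ dist x y) (r : Setoid Y) (T : Set (QSpace r))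
    (hcard : 2 * Nat.card Y < 2 * Nat.card T + Nat.card ι) :
    ∃ φ : G → T, Isometry φ := by
  classical
  let q : Y → QSpace r := Quotient.mk r
  have hq : ∀ U : QSpace r, q (Quotient.out U) = U := fun U => Quotient.out_eq U
  obtain ⟨i, hi⟩ := exists_intact_fiber π
    (fun y => if h : q y ∈ T then some (⟨q y, h⟩ : T) else none)
    (fun U : T => (Quotient.out U.1 : Y)) (fun U => by
      have h : q (Quotient.out U.1) ∈ T := by rw [hq]; exact U.2
      rw [dif_pos h]
      exact congrArg some (Subtype.ext (hq _))) hcard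
  have hpi : ∀ g, π (e i g) = i := fun g => (hπ i _).mp ⟨g, rfl⟩
  have hT : ∀ g, q (e i g) ∈ T := by
    intro g
    by_contra hg
    obtain ⟨U, hU⟩ := (hi _ (hpi g)).1
    simp [hg] at hU
  have hiso := isometry_mk_of_far r (e := e i) (he i) hD
    (fun g z hz => hfar _ _ fun h => hz ((hπ i z).mpr (h ▸ hpi g)))
    (fun g z hz => (hi _ (hpi g)).2 z (by
      have h : q z = q (e i g) := Quotient.sound (r.symm' hz)
      simp only [h]))
  exact ⟨fun g => ⟨q (e i g), hT g⟩, Isometry.of_dist_eq fun a b => hiso.dist_eq a b⟩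

/-- A scale `l` for which `1024 ^ l` stays below `1 / (2 ε)` while `l` is comparable to
`log (2 / ε)`. -/
theorem exists_scale {ε : ℝ} (hε : 0 < ε) (hε1 : ε < 1 / 4096) :
    ∃ l : ℕ, 0 < l ∧ 2 * ε * 1024 ^ l < 1 ∧ Real.log (2 / ε) ≤ 20 * l := by
  obtain ⟨l, hl1, hl2⟩ := exists_nat_pow_near (x := 1 / (4 * ε)) (y := (1024 : ℝ))
    (by rw [le_div_iff₀ (by positivity)]; linarith) (by norm_num)
  have hl : 0 < l := by
    by_contra h
    have : l = 0 := by omega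
    subst this
    rw [zero_add, pow_one, div_lt_iff₀ (by positivity)] at hl2
    linarith
  refine ⟨l, hl, ?_, ?_⟩
  · rw [le_div_iff₀ (by positivity)] at hl1
    linarith
  · have h1 : 2 / ε ≤ 2 ^ (10 * l + 13) := by
      have h2 : 2 / ε = 8 * (1 / (4 * ε)) := by field_simp; norm_num
      have h3 : (2 : ℝ) ^ (10 * l + 13) = 8 * 1024 ^ (l + 1) := by
        rw [pow_add, pow_mul, pow_succ]; norm_num; ring
      rw [h2, h3]
      linarith
    have h4 : Real.log (2 / ε) ≤ ((10 * l + 13 : ℕ) : ℝ) * Real.log 2 := by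
      rw [← Real.log_pow]
      exact Real.log_le_log (by positivity) h1
    have h5 := Real.log_two_lt_d9
    have h6 : (1 : ℝ) ≤ l := by exact_mod_cast hl
    push_cast at h4
    nlinarith

theorem euclideanDistortion_ge_of_one_lt_card {ε : ℝ} (hε : 1 / 4096 ≤ ε) {X : Type u}
    [MetricSpace X] [Finite X] (hX : 1 < Nat.card X) :
    ENNReal.ofReal (1 / 100 * Real.log (2 / ε)) ≤ euclideanDistortion X := by
  have := Finite.one_lt_card_iff_nontrivial.mp hX
  refine le_trans ?_ (one_le_euclideanDistortion X)
  rw [← ENNReal.ofReal_one]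
  refine ENNReal.ofReal_le_ofReal ?_
  have h1 : Real.log (2 / ε) ≤ Real.log (2 ^ 13) := by
    refine Real.log_le_log (by positivity) ?_
    rw [div_le_iff₀ (by linarith)]
    linarith
  rw [Real.log_pow] at h1
  have := Real.log_two_lt_d9
  push_cast at h1
  linarith

/-- There are arbitrarily large spaces all of whose large `QS` and `SQ` spaces have Euclidean
distortion at least `log (2 / ε) / 100`. For small `ε` the space consists of copies of a space of
large Euclidean distortion with fewer than `1 / (2 ε)` points; then a `QS` or `SQ` space that loses at
most an `ε`-fraction of the points contains an intact copy. For `ε ≥ 1 / 4096` it is enough that the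
space in question has two points. -/
theorem exists_space_euclideanDistortion_qs_sq_ge {ε : ℝ} (hε : 0 < ε) (hε1 : ε < 1) (N : ℕ) :
    ∃ n : ℕ, N ≤ n ∧
      ∃ (Y : Type) (_ : MetricSpace Y) (_ : Finite Y), Nat.card Y = n ∧
        (∀ (S : Set Y) (r : Setoid S),
          (1 - ε) * (n : ℝ) ≤ (Nat.card (QSpace r) : ℝ) →
            ENNReal.ofReal (1 / 100 * Real.log (2 / ε)) ≤ euclideanDistortion (QSpace r)) ∧
        (∀ (r : Setoid Y) (T : Set (QSpace r)),
          (1 - ε) * (n : ℝ) ≤ (Nat.card T : ℝ) →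
            ENNReal.ofReal (1 / 100 * Real.log (2 / ε)) ≤ euclideanDistortion T) := by
  rcases le_or_gt (1 / 4096) ε with hbig | hsmall
  · obtain ⟨n₀, hn₀⟩ := exists_nat_ge (2 / (1 - ε))
    have h1ε : 0 < 1 - ε := by linarith
    set n := max N n₀ with hn
    have hn2 : 2 ≤ (1 - ε) * (n : ℝ) := by
      have h1 : (n₀ : ℝ) ≤ n := by exact_mod_cast le_max_right N n₀
      have h2 := hn₀.trans h1
      rw [div_le_iff₀ h1ε] at h2
      linarith
    have hlt : ∀ k : ℕ, (1 - ε) * (n : ℝ) ≤ (k : ℝ) → 1 < k := by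
      intro k hk
      have : (2 : ℝ) ≤ k := hn2.trans hk
      exact_mod_cast this
    let _ : MetricSpace (Copies (Fin n) Unit) :=
      copiesMetric (Fin n) Unit one_pos (fun x y => by simp)
    have hfin : Finite (Copies (Fin n) Unit) := inferInstanceAs (Finite (Fin n × Unit))
    refine ⟨n, le_max_left _ _, Copies (Fin n) Unit, inferInstance, hfin, ?_, ?_, ?_⟩
    · exact (Nat.card_prod (Fin n) Unit).trans (by simp)
    · intro S r hr
      have : Finite (QSpace r) := inferInstanceAs (Finite (Quotient r))
      exact euclideanDistortion_ge_of_one_lt_card hbig (hlt _ hr)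
    · intro r T hT
      have : Finite (QSpace r) := inferInstanceAs (Finite (Quotient r))
      exact euclideanDistortion_ge_of_one_lt_card hbig (hlt _ hT)
  · obtain ⟨l, hl, hl1, hl2⟩ := exists_scale hε hsmall
    obtain ⟨hG, hD, hdist⟩ := exists_metric_euclideanDistortion_ge hl
    have hD0 : (0 : ℝ) < l + 1 := by positivity
    set p := N + 1 with hp
    let Y := Copies (Fin p) (Fin (10 * l) → ZMod 2)
    let hY : MetricSpace Y := copiesMetric (Fin p) _ hD0 hD
    have hfin : Finite Y := inferInstanceAs (Finite (Fin p × (Fin (10 * l) → ZMod 2)))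
    have hcardY : Nat.card Y = p * 1024 ^ l := by
      refine (Nat.card_prod (Fin p) (Fin (10 * l) → ZMod 2)).trans ?_
      simp [ZMod.card, pow_mul]
    have hcard : ∀ k : ℕ, (1 - ε) * ((p * 1024 ^ l : ℕ) : ℝ) ≤ (k : ℝ) →
        2 * Nat.card Y < 2 * k + Nat.card (Fin p) := by
      intro k hk
      rw [hcardY, Nat.card_eq_fintype_card, Fintype.card_fin]
      have hp0 : (0 : ℝ) < p := by positivity
      have h1 : (p : ℝ) * (2 * ε * 1024 ^ l) < p * 1 := mul_lt_mul_of_pos_left hl1 hp0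
      have h2 : (2 * (p * 1024 ^ l : ℕ) : ℝ) < 2 * k + p := by
        push_cast at hk ⊢
        nlinarith
      exact_mod_cast h2
    have hlow : ENNReal.ofReal (1 / 100 * Real.log (2 / ε)) ≤
        euclideanDistortion (Fin (10 * l) → ZMod 2) := by
      refine (ENNReal.ofReal_le_ofReal ?_).trans hdist
      have : (0 : ℝ) < l := by exact_mod_cast hl
      linarith
    let e : Fin p → (Fin (10 * l) → ZMod 2) → Y := fun i g => (i, g)
    have he : ∀ i, Isometry (e i) := fun i => Isometry.of_dist_eq fun a b => if_pos rfl
    have hπ : ∀ (i : Fin p) (y : Y), y ∈ Set.range (e i) ↔ y.1 = i := fun i y =>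
      ⟨by rintro ⟨g, rfl⟩; rfl, by rintro rfl; exact ⟨y.2, rfl⟩⟩
    have hfar : ∀ x y : Y, x.1 ≠ y.1 → (l + 1 : ℝ) ≤ dist x y := fun x y h => (if_neg h).ge
    refine ⟨p * 1024 ^ l, ?_, Y, hY, hfin, hcardY, ?_, ?_⟩
    · calc N ≤ p := Nat.le_succ N
        _ ≤ p * 1024 ^ l := Nat.le_mul_of_pos_right _ (by positivity)
    · intro S r hr
      obtain ⟨φ, hφ⟩ := exists_isometry_qspace_subset (fun y : Y => y.1) e he hπ hD hfar S r
        (hcard _ hr)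
      exact hlow.trans (euclideanDistortion_le_of_isometry hφ)
    · intro r T hT
      obtain ⟨φ, hφ⟩ := exists_isometry_subset_qspace (fun y : Y => y.1) e he hπ hD hfar r T
        (hcard _ hT)
      exact hlow.trans (euclideanDistortion_le_of_isometry hφ)

/-! ### Quotients of large size -/

theorem theorem1p7 :
    (∃ C : ℝ, 0 < C ∧ ∀ ε : ℝ, 0 < ε → ε < 1 → ∀ n : ℕ,
      ∀ (M : Type u) [MetricSpace M] [Finite M], Nat.card M = n →
        ∃ A : Set M,
          Nat.card (QuotientBySet A) = ⌈(1 - ε) * (n : ℝ)⌉₊ ∧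
          euclideanDistortion (QuotientBySet A) ≤ ENNReal.ofReal (C * Real.log (2 / ε))) ∧
    (∃ c : ℝ, 0 < c ∧ ∀ ε : ℝ, 0 < ε → ε < 1 → ∀ N : ℕ, ∃ n : ℕ, N ≤ n ∧
      ∃ (Y : Type) (_ : MetricSpace Y) (_ : Finite Y), Nat.card Y = n ∧
        (∀ (S : Set Y) (r : Setoid S),
          (1 - ε) * (n : ℝ) ≤ (Nat.card (QSpace r) : ℝ) →
            ENNReal.ofReal (c * Real.log (2 / ε)) ≤ euclideanDistortion (QSpace r)) ∧
        (∀ (r : Setoid Y) (T : Set (QSpace r)),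
          (1 - ε) * (n : ℝ) ≤ (Nat.card T : ℝ) →
            ENNReal.ofReal (c * Real.log (2 / ε)) ≤ euclideanDistortion T)) := by
  refine ⟨⟨400, by norm_num, fun ε hε hε1 n M _ _ hM => ?_⟩,
    ⟨1 / 100, by norm_num, fun ε hε hε1 N => exists_space_euclideanDistortion_qs_sq_ge hε hε1 N⟩⟩
  subst hM
  exact exists_quotientBySet_euclideanDistortion_le hε hε1 M
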